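/- **Setting.** Let $r,s\ge 1$ be integers, $I_{r,s}=\{1,\dots,r\}\times\{1,\dots,s\}$, and let $p=(p_{ij})$ be a probability mass function on $I_{r,s}$ with $p_{ij}>0$ for all $(i,j)\in I_{r,s}$. Let $(X_1,Y_1),(X_2,Y_2),\dots$ be random vectors on a common probability space (not necessarily independent), each with probability mass function $p$. For a matrix $x\in\mathbb R^{r\times s}$ with nonnegative entries and positive row and column sums, let $\mathcal R(x)_{ij}=\frac{1}{r}\,x_{ij}/\sum_{h}x_{ih}$ and $\mathcal C(x)_{ij}=\frac{1}{s}\,x_{ij}/\sum_{g}x_{gj}$, and let $\mathcal U(x)$ be the limit, if it exists, of the iterative proportional fitting procedure with uniform target margins, that is, of the sequence $\mathcal R(x),\ \mathcal C\mathcal R(x),\ \mathcal R\mathcal C\mathcal R(x),\ \dots$. For $(i,j)\in I_{r,s}$ put $$\hat p^{[n]}_{ij}=\frac1n\sum_{k=1}^n\mathbf 1(X_k=i,Y_k=j),\qquad p^{[n]}_{ij}=\frac1{n+1}\Big\{\sum_{k=1}^n\mathbf 1(X_k=i,Y_k=j)+\frac1{rs}\Big\},\qquad u=\mathcal U(p),\quad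 u^{[n]}=\mathcal U(p^{[n]}).$$ Let $\mathrm{vec}:\mathbb R^{r\times s}\to\mathbb R^{rs}$ be the column-major vectorization, and $\mathcal U'_p(h)=\mathrm{vec}^{-1}(J_{u,p}\,\mathrm{vec}(h))$ for $h\in\mathbb R^{r\times s}$, where $J_{u,p}=-K L_u^{-1}M_pN$ with the following matrices. * $K$ is the $rs\times(r-1)(s-1)$ matrix $$K=\begin{bmatrix}H&0&\dots&0\\0&H&\dots&0\\ \vdots&\vdots&\ddots&\vdots\\0&0&\dots&H\\-H&-H&\dots&-H\end{bmatrix},$$ where $H\in\mathbb R^{r\times(r-1)}$ is the identity matrix of size $r-1$ with an additional last row of entries $-1$. * $L_u$ is the $(r-1)(s-1)\times(r-1)(s-1)$ matrix whose element at row $k+(r-1)(l-1)$ and column $i+(r-1)(j-1)$, for $1\le k,i\le r-1$ and $1\le l,j\le s-1$, is $$\frac{\mathbf 1(i=k,j=l)}{u_{kl}}+\frac{\mathbf 1(j=l)}{s^{-1}-\sum_{g=1}^{r-1}u_{gl}}+\frac{\mathbf 1(i=k)}{r^{-1}-\sum_{h=1}^{s-1}u_{kh}}+\frac1{r^{-1}+s^{-1}-1+\sum_{g=1}^{r-1}\sum_{h=1}^{s-1}u_{gh}}.$$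 * $M_p$ is the $(r-1)(s-1)\times(rs-1)$ matrix whose element at row $k+(r-1)(l-1)$, for $1\le k\le r-1$ and $1\le l\le s-1$, and column $i+r(j-1)$, for $(i,j)\in I_{r,s}\setminus\{(r,s)\}$, is $$-\frac{\mathbf 1(i=k,j=l)}{p_{kl}}+\frac{\mathbf 1(i=r,j=l)}{p_{rl}}+\frac{\mathbf 1(i=k,j=s)}{p_{ks}}+\frac1{1-\sum_{(g,h)\in I_{r,s},\,(g,h)\ne(r,s)}p_{gh}}.$$ * $N$ is the $(rs-1)\times rs$ matrix that deletes the last entry of a vector. **Proposition.** The limits $u$ and $u^{[n]}$ (for every $n$ and every outcome) exist, and $L_u$ is invertible. Let $Z_p$ be a random matrix in $\mathbb R^{r\times s}$. If $\sqrt n(\hat p^{[n]}-p)\leadsto Z_p$ in $\mathbb R^{r\times s}$ as $n\to\infty$, where $\leadsto$ denotes weak convergence, then $$\sqrt n(u^{[n]}-u)=\mathcal U'_p\big(\sqrt n(\hat p^{[n]}-p)\big)+o_P(1),$$ and consequently $\sqrt n(u^{[n]}-u)\leadsto\mathcal U'_p(Z_p)$ in $\mathbb R^{r\times s}$. If, moreover,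 the vectors $(X_k,Y_k)$, $k\ge1$, are independent, then $\mathrm{vec}(Z_p)$ is a centered normal random vector with covariance matrix $\Sigma_p=\mathrm{diag}\{\mathrm{vec}(p)\}-\mathrm{vec}(p)\,\mathrm{vec}(p)^\top$, and $\mathrm{vec}\{\mathcal U'_p(Z_p)\}$ is a centered normal random vector with covariance matrix $J_{u,p}\Sigma_pJ_{u,p}^\top$. In the independent case the assumption is indeed satisfied: $\sqrt n(\hat p^{[n]}-p)\leadsto Z_p$ whenever $\mathrm{vec}(Z_p)$ is centered normal with covariance matrix $\Sigma_p$. -/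

import Mathlib

open MeasureTheory ProbabilityTheory Filter Topology

noncomputable section

namespace CopulaPMF

/-- The space of real `m × n` matrices, with the product topology, the product (= Borel)
`σ`-algebra and the entrywise maximum norm. -/
abbrev Mat (m n : ℕ) : Type := Fin m → Fin n → ℝ

/-! ### The iterative proportional fitting procedure -/

/-- Rescaling of the rows of `x`, so that the row sums become `a`. -/
def rowScale {m n : ℕ} (a : Fin m → ℝ) (x : Mat m n) : Mat m n :=
  fun i j => a i * x i j / ∑ h, x i h

/-- Rescaling of the columns of `x`, so that the column sums become `b`. -/
def colScale {m n : ℕ} (b : Fin n → ℝ) (x : Mat m n) : Mat m n :=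
  fun i j => b j * x i j / ∑ g, x g j

/-- The `N`-th step of the procedure: `(C_b ∘ R_a)^(N/2)` for even `N`, and
`R_a ∘ (C_b ∘ R_a)^((N-1)/2)` for odd `N`. -/
def ipfpStep {m n : ℕ} (a : Fin m → ℝ) (b : Fin n → ℝ) (N : ℕ) (x : Mat m n) : Mat m n :=
  if Even N then (colScale b ∘ rowScale a)^[N / 2] x
  else rowScale a ((colScale b ∘ rowScale a)^[N / 2] x)

/-- The procedure started at `x`, with target margins `a` and `b`, converges. -/
def IPFPConverges {m n : ℕ} (a : Fin m → ℝ) (b : Fin n → ℝ) (x : Mat m n) : Prop :=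
  ∃ y : Mat m n, Tendsto (fun N => ipfpStep a b N x) atTop (𝓝 y)

/-- The limit of the procedure (meaningful when it converges). -/
def ipfp {m n : ℕ} (a : Fin m → ℝ) (b : Fin n → ℝ) (x : Mat m n) : Mat m n :=
  limUnder atTop (fun N => ipfpStep a b N x)

/-- The uniform probability mass function on a set with `m` elements. -/
def unif (m : ℕ) : Fin m → ℝ := fun _ => 1 / (m : ℝ)

/-- The limit of the procedure for uniform target margins. -/
def unifIPFP {m n : ℕ} (x : Mat m n) : Mat m n := ipfp (unif m) (unif n) x

/-! ### Estimators -/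

section Estimators

variable {Ω : Type*} {m n : ℕ}

/-- The number of indices `k` among the first `N` with `(X k, Y k) = (i, j)`. -/
def counts (X : ℕ → Ω → Fin m) (Y : ℕ → Ω → Fin n) (N : ℕ) (ω : Ω) : Mat m n :=
  fun i j => ∑ k ∈ Finset.range N, if X k ω = i ∧ Y k ω = j then 1 else 0

/-- The empirical probability mass function of the first `N` observations. -/
def empPMF (X : ℕ → Ω → Fin m) (Y : ℕ → Ω → Fin n) (N : ℕ) (ω : Ω) : Mat m n :=
  fun i j => 1 / (N : ℝ) * counts X Y N ω i j

/-- The smoothed empirical probability mass function of the first `N` observations. -/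
def smoothPMF (X : ℕ → Ω → Fin m) (Y : ℕ → Ω → Fin n) (N : ℕ) (ω : Ω) : Mat m n :=
  fun i j => 1 / ((N : ℝ) + 1) * (counts X Y N ω i j + 1 / ((m : ℝ) * (n : ℝ)))

/-- The empirical copula probability mass function of the first `N` observations. -/
def empCopula (X : ℕ → Ω → Fin m) (Y : ℕ → Ω → Fin n) (N : ℕ) (ω : Ω) : Mat m n :=
  unifIPFP (smoothPMF X Y N ω)

end Estimators

/-! ### The Jacobian matrix

The numbers of rows and columns are `r + 1` and `s + 1`, so that the index `Fin.last` stands for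
the last row or column, and the sets of the other rows and columns are `Fin r` and `Fin s`. Vectors
of length `(r + 1) * (s + 1)` are indexed by pairs (column, row): the lexicographic order of these
pairs is the column-major order, as for `Matrix.vec`. -/

/-- Column-major vectorization of a matrix. -/
def vec {m n : ℕ} (x : Mat m n) : Fin n × Fin m → ℝ := Matrix.vec (Matrix.of x)

/-- The inverse of the column-major vectorization. -/
def unvec {m n : ℕ} (v : Fin n × Fin m → ℝ) : Mat m n := fun i j => v (j, i)

/-- The identity matrix of size `r` with an additional last row of entries `-1`. -/
def matH (r : ℕ) : Matrix (Fin (r + 1)) (Fin r) ℝ :=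
  Matrix.of fun i k => if i = Fin.last r then -1 else if i = k.castSucc then 1 else 0

/-- `s` diagonal blocks `matH r`, and a last row of blocks `-matH r`. -/
def matK (r s : ℕ) : Matrix (Fin (s + 1) × Fin (r + 1)) (Fin s × Fin r) ℝ :=
  Matrix.of fun q c =>
    if q.1 = Fin.last s then - matH r q.2 c.2
    else if q.1 = c.1.castSucc then matH r q.2 c.2 else 0

/-- The square matrix of size `r * s`, whose rows are indexed by `(l, k)` and columns by `(j, i)`,
with `k, i` rows and `l, j` columns of `u` other than the last. -/
def matL {r s : ℕ} (u : Mat (r + 1) (s + 1)) : Matrix (Fin s × Fin r) (Fin s × Fin r) ℝ :=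
  Matrix.of fun (l, k) (j, i) =>
    (if i = k ∧ j = l then 1 / u k.castSucc l.castSucc else 0)
    + (if j = l then 1 / (1 / ((s : ℝ) + 1) - ∑ g : Fin r, u g.castSucc l.castSucc) else 0)
    + (if i = k then 1 / (1 / ((r : ℝ) + 1) - ∑ h : Fin s, u k.castSucc h.castSucc) else 0)
    + 1 / (1 / ((r : ℝ) + 1) + 1 / ((s : ℝ) + 1) - 1
        + ∑ g : Fin r, ∑ h : Fin s, u g.castSucc h.castSucc)

/-- All cells, as pairs (column, row), except the one in the last row and the last column. -/
abbrev Cells (r s : ℕ) : Type :=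
  {q : Fin (s + 1) × Fin (r + 1) // q ≠ (Fin.last s, Fin.last r)}

/-- The matrix whose rows are indexed by `(l, k)`, with `k` a row and `l` a column of `p` other
than the last, and whose columns are indexed by the cells `(j, i)` other than the last one. -/
def matM {r s : ℕ} (p : Mat (r + 1) (s + 1)) : Matrix (Fin s × Fin r) (Cells r s) ℝ :=
  Matrix.of fun (l, k) ⟨(j, i), _⟩ =>
    - (if i = k.castSucc ∧ j = l.castSucc then 1 / p k.castSucc l.castSucc else 0)
    + (if i = Fin.last r ∧ j = l.castSucc then 1 / p (Fin.last r) l.castSucc else 0)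
    + (if i = k.castSucc ∧ j = Fin.last s then 1 / p k.castSucc (Fin.last s) else 0)
    + 1 / (1 - ∑ c : Cells r s, p c.1.2 c.1.1)

/-- The matrix that deletes the last entry of a vectorized matrix. -/
def matN (r s : ℕ) : Matrix (Cells r s) (Fin (s + 1) × Fin (r + 1)) ℝ :=
  Matrix.of fun c q => if c.1 = q then 1 else 0

/-- `J_{u,p} = - K L_u⁻¹ M_p N`. -/
def matJ {r s : ℕ} (u p : Mat (r + 1) (s + 1)) :
    Matrix (Fin (s + 1) × Fin (r + 1)) (Fin (s + 1) × Fin (r + 1)) ℝ :=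
  - (matK r s * (matL u)⁻¹ * matM p * matN r s)

/-- The linear map `h ↦ vec⁻¹ (J_{u,p} vec h)` for `u` the limit of the procedure at `p` with
uniform target margins. -/
def unifIPFPDeriv {r s : ℕ} (p h : Mat (r + 1) (s + 1)) : Mat (r + 1) (s + 1) :=
  unvec ((matJ (unifIPFP p) p).mulVec (vec h))

/-- `diag (vec p) - vec p (vec p)ᵀ`. -/
def covMat {m n : ℕ} (p : Mat m n) : Matrix (Fin n × Fin m) (Fin n × Fin m) ℝ :=
  Matrix.diagonal (vec p) - Matrix.vecMulVec (vec p) (vec p)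

end CopulaPMF

end

/-! The limit of the fitting procedure is characterised by its margins and its odds ratios. Row and
column scalings preserve odds ratios, so a uniform lower bound on them holds along the whole
iteration. It forces each scaling to shrink the relative error of the margins by a fixed factor
(`RowReady.rowScale`), so the iterates converge geometrically to a positive matrix with the target
margins and the odds ratios of the start (`exists_tendsto_ipfpStep`). Such a matrix is unique
(`IsFit.eq`), by monotonicity of the logarithm.

Differentiability follows from the inverse function theorem. Matrices with the margins of `u` are `u
+ Kθ`, and log odds ratios are `Kᵀ log`. The map from `θ` to the log odds ratios of `u + Kθ` has
derivative `Kᵀ diag(1/u) K = L_u` at `0`, which is positive definite. Hence the derivative of the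
fit at `p` is `K L_u⁻¹ Kᵀ diag(1/p)`, and on matrices with total `0` it agrees with `J_{u,p}`
(`exists_hasFDerivAt_unifIPFP`).

The limit theorem is then the delta method: smoothing moves the empirical mass function by at most
`1/(n+1)`, and tightness controls the remainder. The normal limit for independent data comes from
the scalar central limit theorem through characteristic functions. -/

namespace CopulaPMF

/-! ### Convergence of iterative proportional fitting, and uniqueness of the fit. -/

section IPFP

variable {m n : ℕ}

/-- All odds ratios of `x` are at least `c`. -/
def OddsBound (c : ℝ) (x : Mat m n) : Prop :=
  ∀ i j g h, c * (x i h * x g j) ≤ x i j * x g h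

/-- `x` and `y` have the same odds ratios. -/
def SameOdds (x y : Mat m n) : Prop :=
  ∀ i j g h, y i j * y g h * (x i h * x g j) = x i j * x g h * (y i h * y g j)

/-- The transpose of a matrix. -/
def transp (x : Mat m n) : Mat n m := fun j i => x i j

theorem colScale_eq_transp (b : Fin n → ℝ) (x : Mat m n) :
    colScale b x = transp (rowScale b (transp x)) := rfl

theorem OddsBound.transp {c : ℝ} {x : Mat m n} (h : OddsBound c x) : OddsBound c (transp x) := by
  intro i j g k
  have := h j i k g
  simp only [CopulaPMF.transp]
  linarith [mul_comm (x k i) (x j g)]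

theorem SameOdds.refl (x : Mat m n) : SameOdds x x := fun _ _ _ _ => rfl

theorem SameOdds.transp {x y : Mat m n} (h : SameOdds x y) :
    SameOdds (transp x) (transp y) := by
  intro i j g k
  have := h j i k g
  simp only [CopulaPMF.transp]
  linear_combination this

theorem rowScale_pos {a : Fin m → ℝ} {x : Mat m n} (ha : ∀ i, 0 < a i)
    (hx : ∀ i j, 0 < x i j) (i : Fin m) (j : Fin n) : 0 < rowScale a x i j :=
  div_pos (mul_pos (ha i) (hx i j)) (Finset.sum_pos (fun h _ => hx i h) ⟨j, Finset.mem_univ _⟩)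

theorem rowScale_eq (a : Fin m → ℝ) (x : Mat m n) (i : Fin m) (j : Fin n) :
    rowScale a x i j = a i / (∑ h, x i h) * x i j := by
  simp only [rowScale]; ring

/-- Both products pick up the same two row factors, so the constant `c` survives every scaling step.
-/
theorem OddsBound.rowScale {c : ℝ} {a : Fin m → ℝ} {x : Mat m n} (ha : ∀ i, 0 < a i)
    (hx : ∀ i j, 0 < x i j) (h : OddsBound c x) : OddsBound c (rowScale a x) := by
  intro i j g k
  simp only [rowScale_eq]
  have hs : ∀ i, 0 ≤ a i / (∑ h, x i h) := fun i =>
    div_nonneg (ha i).le (Finset.sum_nonneg fun h _ => (hx i h).le)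
  have := mul_le_mul_of_nonneg_left (h i j g k) (mul_nonneg (hs i) (hs g))
  linarith

theorem SameOdds.rowScale {x y : Mat m n} (h : SameOdds x y) (a : Fin m → ℝ) :
    SameOdds x (rowScale a y) := by
  intro i j g k
  simp only [rowScale_eq]
  linear_combination (a i / (∑ h, y i h)) * (a g / (∑ h, y g h)) * h i j g k

theorem sum_rowScale {a : Fin m → ℝ} {x : Mat m n} (hx : ∀ i j, 0 < x i j) (i : Fin m)
    (j : Fin n) : ∑ h, CopulaPMF.rowScale a x i h = a i := by
  have hs : 0 < ∑ h, x i h := Finset.sum_pos (fun h _ => hx i h) ⟨j, Finset.mem_univ _⟩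
  simp only [rowScale_eq, ← Finset.mul_sum]
  field_simp

/-- Sum the odds inequality over the opposite corner `(g, k)`. Given the margins, this bounds every
entry from below; both the contraction and the positivity of the limit rest on it. -/
theorem OddsBound.mul_sum_le {c : ℝ} {x : Mat m n} (h : OddsBound c x) (i : Fin m) (j : Fin n) :
    c * ((∑ k, x i k) * ∑ g, x g j) ≤ x i j * ∑ g, ∑ k, x g k := by
  rw [Finset.sum_mul_sum, Finset.sum_comm, Finset.mul_sum, Finset.mul_sum]
  refine Finset.sum_le_sum fun g _ => ?_
  rw [Finset.mul_sum, Finset.mul_sum]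
  exact Finset.sum_le_sum fun k _ => h i j g k

/-- A positive matrix with column sums `b`, all odds ratios at least `c`, and row sums
proportional to `a` up to the factor `1 + t`. -/
structure RowReady (a : Fin m → ℝ) (b : Fin n → ℝ) (c t : ℝ) (z : Mat m n) : Prop where
  pos : ∀ i j, 0 < z i j
  col : ∀ j, ∑ g, z g j = b j
  odds : OddsBound c z
  ratio : ∀ i i', (∑ h, z i h) / a i ≤ (1 + t) * ((∑ h, z i' h) / a i')

/-- The contraction step. The new column sums are averages of the factors `1 / v i`, which spread by
at most `1 + t`. The row `i₀` has the smallest factor and holds a share of at least `c * κ` of every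
column, which removes that share of the excess `t`. The conclusion is transposed so that the same
lemma serves for column scalings. -/
theorem RowReady.rowScale {a : Fin m → ℝ} {b : Fin n → ℝ} {c t κ : ℝ} {z : Mat m n}
    (hz : RowReady a b c t z) (ha : ∀ i, 0 < a i) (hb : ∀ j, 0 < b j) (ha1 : ∑ i, a i = 1)
    (hb1 : ∑ j, b j = 1) (ht : 0 ≤ t) (hc : 0 ≤ c) (hκ : ∀ i, κ ≤ a i) :
    RowReady b a c ((1 - c * κ) * t) (transp (rowScale a z)) ∧
      ∀ i j, |CopulaPMF.rowScale a z i j - z i j| ≤ t := by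
  have hm : Nonempty (Fin m) := by
    by_contra h
    rw [not_nonempty_iff] at h
    simp at ha1
  have hn : Nonempty (Fin n) := by
    by_contra h
    rw [not_nonempty_iff] at h
    simp at hb1
  obtain ⟨i₀, hi₀⟩ := Finite.exists_max fun i => (∑ h, z i h) / a i
  set v : Fin m → ℝ := fun i => (∑ h, z i h) / a i with hv
  have hρ : ∀ i, 0 < ∑ h, z i h := fun i => Finset.sum_pos (fun h _ => hz.pos i h)
    Finset.univ_nonempty
  have hvpos : ∀ i, 0 < v i := fun i => div_pos (hρ i) (ha i)
  have hva : ∀ i, ∑ h, z i h = a i * v i := fun i => by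
    simp only [hv]; field_simp [(ha i).ne']
  have htot : ∑ i, ∑ h, z i h = 1 := by
    rw [Finset.sum_comm]; simp only [hz.col, hb1]
  have hav : ∑ i, a i * v i = 1 := by simp only [← hva, htot]
  -- The `a`-weighted mean of `v` is `1`, so its maximum is at least `1`; likewise all `v i` lie
  -- between `1 / (1 + t)` and `1 + t`.
  have hM1 : 1 ≤ v i₀ := by
    have : ∑ i, a i * v i ≤ ∑ i, a i * v i₀ :=
      Finset.sum_le_sum fun i _ => mul_le_mul_of_nonneg_left (hi₀ i) (ha i).le
    rw [hav, ← Finset.sum_mul, ha1, one_mul] at this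
    exact this
  have hlow : ∀ i, v i₀ ≤ (1 + t) * v i := fun i => hz.ratio i₀ i
  have hlow1 : ∀ i, 1 ≤ (1 + t) * v i := fun i => hM1.trans (hlow i)
  have hup1 : ∀ i, v i ≤ 1 + t := by
    intro i
    have : ∑ k, a k * v i ≤ ∑ k, a k * ((1 + t) * v k) :=
      Finset.sum_le_sum fun k _ => mul_le_mul_of_nonneg_left (hz.ratio i k) (ha k).le
    rw [← Finset.sum_mul, ha1, one_mul] at this
    have h2 : ∑ k, a k * ((1 + t) * v k) = (1 + t) * ∑ k, a k * v k := by
      rw [Finset.mul_sum]; exact Finset.sum_congr rfl fun k _ => by ring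
    rw [h2, hav, mul_one] at this
    exact this
  have hz' : ∀ i j, CopulaPMF.rowScale a z i j = z i j * (v i)⁻¹ := by
    intro i j
    rw [rowScale_eq, hv]
    simp only [inv_div]; ring
  have hinv : ∀ i, (v i)⁻¹ ≤ (1 + t) * (v i₀)⁻¹ := by
    intro i
    rw [← div_eq_mul_inv, inv_le_iff_one_le_mul₀ (hvpos i), div_mul_eq_mul_div,
      one_le_div (hvpos i₀)]
    exact hlow i
  have hinv0 : ∀ i, (v i₀)⁻¹ ≤ (v i)⁻¹ := fun i => inv_anti₀ (hvpos i) (hi₀ i)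
  have hw : ∀ j, c * κ * b j ≤ z i₀ j := by
    intro j
    have h1 := hz.odds.mul_sum_le i₀ j
    rw [htot, hz.col, hva, mul_one] at h1
    refine le_trans ?_ h1
    have : κ ≤ a i₀ * v i₀ := (hκ i₀).trans (le_mul_of_one_le_right (ha i₀).le hM1)
    rw [mul_assoc]
    exact mul_le_mul_of_nonneg_left (mul_le_mul_of_nonneg_right this (hb j).le) hc
  have hV : 0 < (v i₀)⁻¹ := inv_pos.2 (hvpos i₀)
  have hcol_le : ∀ j, ∑ i, CopulaPMF.rowScale a z i j
      ≤ b j * ((1 + (1 - c * κ) * t) * (v i₀)⁻¹) := by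
    intro j
    -- Every row is charged the worst factor `(1 + t) / v i₀`, except `i₀`, whose factor is exactly
    -- `1 / v i₀`.
    have h1 : ∑ i, CopulaPMF.rowScale a z i j ≤
        ∑ i, (z i j * ((1 + t) * (v i₀)⁻¹) - if i = i₀ then z i₀ j * (t * (v i₀)⁻¹) else 0) := by
      refine Finset.sum_le_sum fun i _ => ?_
      rw [hz']
      split_ifs with h
      · subst h; linarith
      · rw [sub_zero]
        exact mul_le_mul_of_nonneg_left (hinv i) (hz.pos i j).le
    rw [Finset.sum_sub_distrib, ← Finset.sum_mul, hz.col] at h1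
    simp only [Finset.sum_ite_eq', Finset.mem_univ, if_true] at h1
    have h2 := mul_le_mul_of_nonneg_right (hw j) (mul_nonneg ht hV.le)
    linarith
  have hcol_ge : ∀ j, b j * (v i₀)⁻¹ ≤ ∑ i, CopulaPMF.rowScale a z i j := by
    intro j
    rw [← hz.col j, Finset.sum_mul]
    refine Finset.sum_le_sum fun i _ => ?_
    rw [hz']
    exact mul_le_mul_of_nonneg_left (hinv0 i) (hz.pos i j).le
  have hcκ : c * κ ≤ 1 := by
    obtain ⟨j⟩ := hn
    have h1 : z i₀ j ≤ b j := by
      rw [← hz.col j]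
      exact Finset.single_le_sum (f := fun g => z g j) (fun g _ => (hz.pos g j).le)
        (Finset.mem_univ i₀)
    have := (hw j).trans h1
    by_contra hcon
    push Not at hcon
    nlinarith [hb j]
  refine ⟨⟨fun j i => rowScale_pos ha hz.pos i j, fun i => ?_, (hz.odds.rowScale ha hz.pos).transp,
    fun j j' => ?_⟩, fun i j => ?_⟩
  · obtain ⟨j⟩ := hn
    exact sum_rowScale hz.pos i j
  · have h1 : (∑ i, CopulaPMF.rowScale a z i j) / b j ≤ (1 + (1 - c * κ) * t) * (v i₀)⁻¹ := by
      rw [div_le_iff₀ (hb j)]; linarith [hcol_le j]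
    have h2 : (v i₀)⁻¹ ≤ (∑ i, CopulaPMF.rowScale a z i j') / b j' := by
      rw [le_div_iff₀ (hb j')]; linarith [hcol_ge j']
    have h3 : 0 ≤ 1 + (1 - c * κ) * t := by
      have := mul_nonneg (sub_nonneg.2 hcκ) ht
      linarith
    exact h1.trans (mul_le_mul_of_nonneg_left h2 h3)
  · have hz1 : z i j ≤ 1 := by
      have h1 : z i j ≤ ∑ h, z i h :=
        Finset.single_le_sum (f := fun h => z i h) (fun h _ => (hz.pos i h).le) (Finset.mem_univ j)
      have h2 : ∑ h, z i h ≤ ∑ i, ∑ h, z i h :=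
        Finset.single_le_sum (f := fun i => ∑ h, z i h) (fun i _ => (hρ i).le) (Finset.mem_univ i)
      linarith
    have hzp := hz.pos i j
    have e : CopulaPMF.rowScale a z i j - z i j = z i j * ((v i)⁻¹ - 1) := by rw [hz']; ring
    have hA : |(v i)⁻¹ - 1| ≤ t := by
      have h1 : (v i)⁻¹ ≤ 1 + t := by
        rw [inv_le_iff_one_le_mul₀ (hvpos i)]; exact hlow1 i
      have h2 : (1 + t)⁻¹ ≤ (v i)⁻¹ := inv_anti₀ (hvpos i) (hup1 i)
      have h3 : 1 - t ≤ (1 + t)⁻¹ := by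
        rw [← one_div, le_div_iff₀ (by linarith)]; nlinarith
      rw [abs_le]; constructor <;> linarith
    rw [e, abs_mul, abs_of_pos hzp]
    nlinarith [abs_nonneg ((v i)⁻¹ - 1)]

theorem ipfpStep_succ (a : Fin m → ℝ) (b : Fin n → ℝ) (N : ℕ) (x : Mat m n) :
    ipfpStep a b (N + 1) x =
      if Even N then rowScale a (ipfpStep a b N x) else colScale b (ipfpStep a b N x) := by
  by_cases h : Even N
  · have h1 : ¬ Even (N + 1) := by simpa [Nat.even_add_one] using h
    have h2 : (N + 1) / 2 = N / 2 := by obtain ⟨k, rfl⟩ := h; omega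
    simp only [ipfpStep, h, h1, if_true, if_false, h2]
  · have h1 : Even (N + 1) := by simpa [Nat.even_add_one] using h
    have h2 : (N + 1) / 2 = N / 2 + 1 := by
      rw [Nat.not_even_iff_odd] at h; obtain ⟨k, rfl⟩ := h; omega
    simp only [ipfpStep, h, h1, if_true, if_false, h2, Function.iterate_succ', Function.comp]

theorem exists_pos_le_of_finite {ι : Type*} [Finite ι] {f : ι → ℝ} (hf : ∀ i, 0 < f i) :
    ∃ c, 0 < c ∧ ∀ i, c ≤ f i := by
  cases isEmpty_or_nonempty ι
  · exact ⟨1, one_pos, fun i => isEmptyElim i⟩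
  · obtain ⟨i, hi⟩ := Finite.exists_min f
    exact ⟨f i, hf i, hi⟩

theorem exists_oddsBound {x : Mat m n} (hx : ∀ i j, 0 < x i j) : ∃ c, 0 < c ∧ OddsBound c x := by
  obtain ⟨c, hc, h⟩ := exists_pos_le_of_finite
    (f := fun q : (Fin m × Fin n) × Fin m × Fin n =>
      x q.1.1 q.1.2 * x q.2.1 q.2.2 / (x q.1.1 q.2.2 * x q.2.1 q.1.2))
    (fun q => div_pos (mul_pos (hx _ _) (hx _ _)) (mul_pos (hx _ _) (hx _ _)))
  refine ⟨c, hc, fun i j g k => ?_⟩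
  have := h ((i, j), g, k)
  rwa [le_div_iff₀ (mul_pos (hx _ _) (hx _ _))] at this

/-- A fit of the positive matrix `x` to the margins `a` and `b`: a positive matrix with these
margins and the odds ratios of `x`. -/
structure IsFit (a : Fin m → ℝ) (b : Fin n → ℝ) (x y : Mat m n) : Prop where
  pos : ∀ i j, 0 < y i j
  row : ∀ i, ∑ h, y i h = a i
  col : ∀ j, ∑ g, y g j = b j
  odds : SameOdds x y

theorem ipfpStep_sameOdds (a : Fin m → ℝ) (b : Fin n → ℝ) (x : Mat m n) (N : ℕ) :
    SameOdds x (ipfpStep a b N x) := by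
  induction N with
  | zero => simpa [ipfpStep] using SameOdds.refl x
  | succ N ih =>
    rw [ipfpStep_succ]
    split_ifs
    · exact ih.rowScale a
    · rw [colScale_eq_transp]
      exact (ih.transp.rowScale b).transp

theorem exists_tendsto_ipfpStep {a : Fin m → ℝ} {b : Fin n → ℝ} {x : Mat m n}
    (ha : ∀ i, 0 < a i) (hb : ∀ j, 0 < b j) (ha1 : ∑ i, a i = 1) (hb1 : ∑ j, b j = 1)
    (hx : ∀ i j, 0 < x i j) :
    ∃ y, Tendsto (fun N => ipfpStep a b N x) atTop (𝓝 y) ∧ IsFit a b x y := by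
  have hm : Nonempty (Fin m) := by
    by_contra h
    rw [not_nonempty_iff] at h
    simp at ha1
  have hn : Nonempty (Fin n) := by
    by_contra h
    rw [not_nonempty_iff] at h
    simp at hb1
  obtain ⟨c, hc, hodds⟩ := exists_oddsBound hx
  obtain ⟨κ₁, hκ₁, h₁⟩ := exists_pos_le_of_finite ha
  obtain ⟨κ₂, hκ₂, h₂⟩ := exists_pos_le_of_finite hb
  set κ := min κ₁ κ₂ with hκ
  have hκpos : 0 < κ := lt_min hκ₁ hκ₂
  have hκa : ∀ i, κ ≤ a i := fun i => (min_le_left _ _).trans (h₁ i)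
  have hκb : ∀ i, κ ≤ b i := fun i => (min_le_right _ _).trans (h₂ i)
  set q := 1 - c * κ with hq
  have hq1 : q < 1 := by have := mul_pos hc hκpos; linarith
  have hq0 : 0 ≤ q := by
    obtain ⟨i⟩ := hm
    obtain ⟨j⟩ := hn
    have hc1 : c ≤ 1 := by
      have := hodds i j i j
      have h2 := mul_pos (hx i j) (hx i j)
      by_contra hcon
      push Not at hcon
      nlinarith
    have : a i ≤ 1 := by
      rw [← ha1]
      exact Finset.single_le_sum (fun i _ => (ha i).le) (Finset.mem_univ i)
    have : κ ≤ 1 := (hκa i).trans this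
    nlinarith
  -- Shifted by one, so that each `w N` already has one exact margin: the rows for even `N`, the
  -- columns for odd `N`.
  set w : ℕ → Mat m n := fun N => ipfpStep a b (N + 1) x with hw
  have hw0 : w 0 = rowScale a x := by simp [hw, ipfpStep]
  have hws : ∀ N, w (N + 1) = if Even N then colScale b (w N) else rowScale a (w N) := by
    intro N
    simp only [hw]
    rw [ipfpStep_succ]
    by_cases h : Even N <;> simp [Nat.even_add_one, h]
  obtain ⟨t, ht, hinit⟩ : ∃ t, 0 ≤ t ∧ RowReady b a c t (transp (w 0)) := by
    have hpos : ∀ i j, 0 < w 0 i j := fun i j => by rw [hw0]; exact rowScale_pos ha hx i j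
    have hcs : ∀ j, 0 < (∑ g, w 0 g j) / b j := fun j =>
      div_pos (Finset.sum_pos (fun g _ => hpos g j) Finset.univ_nonempty) (hb j)
    obtain ⟨d, hd, hdd⟩ := exists_pos_le_of_finite hcs
    obtain ⟨j₀, hj₀⟩ := Finite.exists_max fun j => (∑ g, w 0 g j) / b j
    -- Largest over a lower bound of the column ratios: any ratio is at most `t` times any other,
    -- hence at most `1 + t` times.
    refine ⟨((∑ g, w 0 g j₀) / b j₀) / d, div_nonneg (hcs j₀).le hd.le,
      ⟨fun j i => hpos i j, fun i => ?_, ?_, fun j j' => ?_⟩⟩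
    · obtain ⟨j⟩ := hn
      simp only [transp, hw0]
      exact sum_rowScale hx i j
    · rw [hw0]
      exact (hodds.rowScale ha hx).transp
    · refine (hj₀ j).trans ?_
      have h3 : 0 ≤ ((∑ g, w 0 g j₀) / b j₀) / d := div_nonneg (hcs j₀).le hd.le
      have h4 := mul_le_mul_of_nonneg_left (hdd j') h3
      rw [div_mul_cancel₀ _ hd.ne'] at h4
      have h5 := hcs j'
      simp only [transp]
      linarith
  have htN : ∀ N, 0 ≤ q ^ N * t := fun N => mul_nonneg (pow_nonneg hq0 N) ht
  have hready : ∀ N, (Even N → RowReady b a c (q ^ N * t) (transp (w N))) ∧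
      (¬ Even N → RowReady a b c (q ^ N * t) (w N)) := by
    intro N
    induction N with
    | zero => exact ⟨fun _ => by simpa using hinit, fun h => absurd (by simp) h⟩
    | succ N ih =>
      rw [hws, pow_succ', mul_assoc]
      by_cases h : Even N
      · refine ⟨fun h' => absurd h (by simpa [Nat.even_add_one] using h'), fun _ => ?_⟩
        rw [if_pos h, colScale_eq_transp]
        exact ((ih.1 h).rowScale hb ha hb1 ha1 (htN N) hc.le hκb).1
      · refine ⟨fun _ => ?_, fun h' => absurd h (by simpa [Nat.even_add_one] using h')⟩
        rw [if_neg h]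
        exact ((ih.2 h).rowScale ha hb ha1 hb1 (htN N) hc.le hκa).1
  have hdist : ∀ N, dist (w N) (w (N + 1)) ≤ t * q ^ N := by
    intro N
    rw [mul_comm]
    refine (dist_pi_le_iff (htN N)).2 fun i => (dist_pi_le_iff (htN N)).2 fun j => ?_
    rw [dist_comm, Real.dist_eq, hws]
    by_cases h : Even N
    · rw [if_pos h]
      exact (((hready N).1 h).rowScale hb ha hb1 ha1 (htN N) hc.le hκb).2 j i
    · rw [if_neg h]
      exact (((hready N).2 h).rowScale ha hb ha1 hb1 (htN N) hc.le hκa).2 i j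
  obtain ⟨y, hy⟩ := cauchySeq_tendsto_of_complete (cauchySeq_of_le_geometric q t hq1 hdist)
  have hyx : Tendsto (fun N => ipfpStep a b N x) atTop (𝓝 y) :=
    (tendsto_add_atTop_iff_nat (f := fun N => ipfpStep a b N x) 1).1 hy
  have hyij : ∀ i j, Tendsto (fun N => w N i j) atTop (𝓝 (y i j)) := fun i j =>
    tendsto_pi_nhds.1 (tendsto_pi_nhds.1 hy i) j
  have heven : Tendsto (fun N : ℕ => 2 * N) atTop atTop :=
    tendsto_atTop_mono (fun N => by simp only [id]; omega) tendsto_id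
  have hodd : Tendsto (fun N : ℕ => 2 * N + 1) atTop atTop :=
    tendsto_atTop_mono (fun N => by simp only [id]; omega) tendsto_id
  have hrow : ∀ i, ∑ h, y i h = a i := by
    intro i
    have h3 : Tendsto (fun N => ∑ h, w (2 * N) i h) atTop (𝓝 (∑ h, y i h)) :=
      tendsto_finsetSum _ fun h _ => (hyij i h).comp heven
    refine tendsto_nhds_unique h3 (tendsto_const_nhds.congr fun N => ?_)
    exact (((hready (2 * N)).1 (by simp)).col i).symm
  have hcol : ∀ j, ∑ g, y g j = b j := by
    intro j
    have h3 : Tendsto (fun N => ∑ g, w (2 * N + 1) g j) atTop (𝓝 (∑ g, y g j)) :=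
      tendsto_finsetSum _ fun g _ => (hyij g j).comp hodd
    refine tendsto_nhds_unique h3 (tendsto_const_nhds.congr fun N => ?_)
    exact (((hready (2 * N + 1)).2 (by simp)).col j).symm
  have hyodds : OddsBound c y := by
    intro i j g k
    refine le_of_tendsto_of_tendsto' (((hyij i k).mul (hyij g j)).const_mul c)
      ((hyij i j).mul (hyij g k)) fun N => ?_
    by_cases h : Even N
    · exact ((hready N).1 h).odds.transp i j g k
    · exact ((hready N).2 h).odds i j g k
  refine ⟨y, hyx, ⟨fun i j => ?_, hrow, hcol, fun i j g k => ?_⟩⟩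
  -- Limits of positive entries could vanish; the odds bound passes to the limit and gives `y i j ≥
  -- c * a i * b j`.
  · have := hyodds.mul_sum_le i j
    simp only [hrow, hcol, ha1, mul_one] at this
    exact lt_of_lt_of_le (mul_pos hc (mul_pos (ha i) (hb j))) this
  · refine tendsto_nhds_unique
      (((hyij i j).mul (hyij g k)).mul_const _) ((((hyij i k).mul (hyij g j)).const_mul _).congr
        fun N => ?_)
    exact (ipfpStep_sameOdds a b x (N + 1) i j g k).symm

/-- Two positive matrices with the same margins and the same odds ratios are equal. -/
theorem IsFit.eq {a : Fin m → ℝ} {b : Fin n → ℝ} {x y z : Mat m n} (hx : ∀ i j, 0 < x i j)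
    (hy : IsFit a b x y) (hz : IsFit a b x z) : y = z := by
  by_cases hmn : Nonempty (Fin m) ∧ Nonempty (Fin n)
  swap
  · funext i j
    exact absurd ⟨⟨i⟩, ⟨j⟩⟩ hmn
  obtain ⟨⟨i₀⟩, ⟨j₀⟩⟩ := hmn
  set d : Mat m n := fun i j => Real.log (y i j) - Real.log (z i j) with hd
  have hlog : ∀ w : Mat m n, (∀ i j, 0 < w i j) → SameOdds x w → ∀ i j,
      Real.log (w i j) + Real.log (w i₀ j₀) - Real.log (w i j₀) - Real.log (w i₀ j) =
      Real.log (x i j) + Real.log (x i₀ j₀) - Real.log (x i j₀) - Real.log (x i₀ j) := by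
    intro w hw h i j
    have := congrArg Real.log (h i j i₀ j₀)
    have hx' := fun i j => (hx i j).ne'
    have hw' := fun i j => (hw i j).ne'
    rw [Real.log_mul (mul_ne_zero (hw' _ _) (hw' _ _)) (mul_ne_zero (hx' _ _) (hx' _ _)),
      Real.log_mul (mul_ne_zero (hx' _ _) (hx' _ _)) (mul_ne_zero (hw' _ _) (hw' _ _)),
      Real.log_mul (hw' _ _) (hw' _ _), Real.log_mul (hw' _ _) (hw' _ _),
      Real.log_mul (hx' _ _) (hx' _ _), Real.log_mul (hx' _ _) (hx' _ _)] at this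
    linarith
  have hdd : ∀ i j, d i j = d i j₀ + (d i₀ j - d i₀ j₀) := by
    intro i j
    have h1 := hlog y hy.pos hy.odds i j
    have h2 := hlog z hz.pos hz.odds i j
    simp only [hd]; linarith
  -- `d` is a row term plus a column term, and `y - z` has zero margins, so the two are orthogonal.
  -- As `log` is increasing, no summand is negative, so all vanish.
  have hsum : ∑ i, ∑ j, (y i j - z i j) * d i j = 0 := by
    have e : ∀ i j, (y i j - z i j) * d i j =
        (y i j - z i j) * d i j₀ + (y i j - z i j) * (d i₀ j - d i₀ j₀) := fun i j => by
      rw [hdd i j]; ring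
    simp only [e, Finset.sum_add_distrib]
    rw [Finset.sum_comm (f := fun i j => (y i j - z i j) * (d i₀ j - d i₀ j₀))]
    simp only [← Finset.sum_mul, Finset.sum_sub_distrib, hy.row, hz.row, hy.col, hz.col, sub_self,
      zero_mul, Finset.sum_const_zero, add_zero]
  have hterm : ∀ i j, 0 ≤ (y i j - z i j) * d i j := by
    intro i j
    rcases le_total (y i j) (z i j) with h | h
    · exact mul_nonneg_of_nonpos_of_nonpos (sub_nonpos.2 h)
        (sub_nonpos.2 (Real.log_le_log (hy.pos i j) h))
    · exact mul_nonneg (sub_nonneg.2 h) (sub_nonneg.2 (Real.log_le_log (hz.pos i j) h))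
  funext i j
  have h1 := (Finset.sum_eq_zero_iff_of_nonneg
    (fun i _ => Finset.sum_nonneg fun j _ => hterm i j)).1 hsum i (Finset.mem_univ i)
  have h2 := (Finset.sum_eq_zero_iff_of_nonneg (fun j _ => hterm i j)).1 h1 j (Finset.mem_univ j)
  rcases mul_eq_zero.1 h2 with h | h
  · exact sub_eq_zero.1 h
  · exact Real.log_injOn_pos (hy.pos i j) (hz.pos i j) (sub_eq_zero.1 h)

theorem sum_unif (m : ℕ) : ∑ i, unif (m + 1) i = 1 := by
  simp only [unif, Finset.sum_const, Finset.card_univ, Fintype.card_fin, nsmul_eq_mul]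
  field_simp

theorem unif_pos (m : ℕ) (i : Fin (m + 1)) : 0 < unif (m + 1) i := by
  simp only [unif]; positivity

theorem exists_tendsto_unif {r s : ℕ} {x : Mat (r + 1) (s + 1)} (hx : ∀ i j, 0 < x i j) :
    ∃ y, Tendsto (fun N => ipfpStep (unif (r + 1)) (unif (s + 1)) N x) atTop (𝓝 y) ∧
      IsFit (unif (r + 1)) (unif (s + 1)) x y :=
  exists_tendsto_ipfpStep (unif_pos r) (unif_pos s) (sum_unif r) (sum_unif s) hx

theorem isFit_unifIPFP {r s : ℕ} {x : Mat (r + 1) (s + 1)} (hx : ∀ i j, 0 < x i j) :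
    IsFit (unif (r + 1)) (unif (s + 1)) x (unifIPFP x) := by
  obtain ⟨y, hy, h⟩ := exists_tendsto_unif hx
  rwa [unifIPFP, ipfp, hy.limUnder_eq]

end IPFP

end CopulaPMF

namespace CopulaPMF

/-! ### Factorisation of the matrices in the Jacobian. -/

section Jacobian

variable {r s : ℕ}

theorem sum_matH_mul (k : Fin r) (f : Fin (r + 1) → ℝ) :
    ∑ i, matH r i k * f i = f k.castSucc - f (Fin.last r) := by
  rw [Fin.sum_univ_castSucc]
  simp [matH, Fin.castSucc_ne_last, ite_mul, sub_eq_add_neg]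

theorem matH_castSucc (i k : Fin r) : matH r i.castSucc k = if i = k then 1 else 0 := by
  simp [matH, Fin.castSucc_ne_last]

theorem matH_last (k : Fin r) : matH r (Fin.last r) k = -1 := by
  simp [matH]

/-- This tensor form makes `K` parametrise the matrices with zero margins, while its transpose takes
double differences against the last row and column. -/
theorem matK_apply (q : Fin (s + 1) × Fin (r + 1)) (c : Fin s × Fin r) :
    matK r s q c = matH s q.1 c.1 * matH r q.2 c.2 := by
  simp only [matK, Matrix.of_apply]
  split_ifs with h1 h2
  · rw [h1, matH_last]; ring
  · rw [h2, matH_castSucc]; simp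
  · simp [matH, h1, h2]

theorem transpose_matK_mulVec (f : Fin (s + 1) × Fin (r + 1) → ℝ) (l : Fin s) (k : Fin r) :
    ((matK r s).transpose.mulVec f) (l, k) =
      f (l.castSucc, k.castSucc) - f (l.castSucc, Fin.last r) -
        (f (Fin.last s, k.castSucc) - f (Fin.last s, Fin.last r)) := by
  simp only [Matrix.mulVec, dotProduct, Matrix.transpose_apply, matK_apply, Fintype.sum_prod_type,
    mul_assoc, ← Finset.mul_sum, sum_matH_mul]

theorem sum_unvec_matK_row (θ : Fin s × Fin r → ℝ) (i : Fin (r + 1)) :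
    ∑ j, unvec ((matK r s).mulVec θ) i j = 0 := by
  simp only [unvec, Matrix.mulVec, dotProduct]
  rw [Finset.sum_comm]
  refine Finset.sum_eq_zero fun c _ => ?_
  simp only [matK_apply, mul_assoc]
  rw [sum_matH_mul, sub_self]

theorem sum_unvec_matK_col (θ : Fin s × Fin r → ℝ) (j : Fin (s + 1)) :
    ∑ i, unvec ((matK r s).mulVec θ) i j = 0 := by
  simp only [unvec, Matrix.mulVec, dotProduct]
  rw [Finset.sum_comm]
  refine Finset.sum_eq_zero fun c _ => ?_
  have : ∀ x, matK r s (j, x) c * θ c = matH r x c.2 * (matH s j c.1 * θ c) := fun x => by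
    rw [matK_apply]; ring
  simp only [this]
  rw [sum_matH_mul, sub_self]

theorem matK_mulVec_castSucc (θ : Fin s × Fin r → ℝ) (c : Fin s × Fin r) :
    ((matK r s).mulVec θ) (c.1.castSucc, c.2.castSucc) = θ c := by
  simp [Matrix.mulVec, dotProduct, matK_apply, matH_castSucc, Fintype.sum_prod_type,
    Finset.sum_ite_eq]

/-- The vector of reciprocals. -/
noncomputable def recip {ι : Type*} (v : ι → ℝ) : ι → ℝ := fun i => (v i)⁻¹

/-- The uniform margins turn the three denominators into the entries of `u` in the last row, the
last column and the corner. So `L_u` is the Hessian of `∑ u log u` in the coordinates `θ`. -/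
theorem matL_eq {u x : Mat (r + 1) (s + 1)} (hu : IsFit (unif (r + 1)) (unif (s + 1)) x u) :
    matL u = (matK r s).transpose * Matrix.diagonal (recip (vec u)) * matK r s := by
  ext ⟨l, k⟩ ⟨j, i⟩
  have h1 : ∀ l : Fin s, 1 / ((s : ℝ) + 1) - ∑ g : Fin r, u g.castSucc l.castSucc
      = u (Fin.last r) l.castSucc := by
    intro l
    have := hu.col l.castSucc
    rw [Fin.sum_univ_castSucc] at this
    simp only [unif] at this
    push_cast at this
    linarith
  have h2 : ∀ k : Fin r, 1 / ((r : ℝ) + 1) - ∑ h : Fin s, u k.castSucc h.castSucc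
      = u k.castSucc (Fin.last s) := by
    intro k
    have := hu.row k.castSucc
    rw [Fin.sum_univ_castSucc] at this
    simp only [unif] at this
    push_cast at this
    linarith
  have h3 : 1 / ((r : ℝ) + 1) + 1 / ((s : ℝ) + 1) - 1
      + ∑ g : Fin r, ∑ h : Fin s, u g.castSucc h.castSucc = u (Fin.last r) (Fin.last s) := by
    have e : ∀ g : Fin r, ∑ h : Fin s, u g.castSucc h.castSucc
        = 1 / ((r : ℝ) + 1) - u g.castSucc (Fin.last s) := fun g => by rw [← h2 g]; ring
    simp only [e, Finset.sum_sub_distrib, Finset.sum_const, Finset.card_univ, Fintype.card_fin,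
      nsmul_eq_mul]
    have := hu.col (Fin.last s)
    rw [Fin.sum_univ_castSucc] at this
    simp only [unif] at this
    push_cast at this
    have hr : (r : ℝ) * (1 / ((r : ℝ) + 1)) = 1 - 1 / ((r : ℝ) + 1) := by
      have : (r : ℝ) + 1 ≠ 0 := by positivity
      field_simp
      ring
    rw [hr]
    linarith
  rw [Matrix.mul_assoc]
  have e : ((matK r s).transpose * (Matrix.diagonal (recip (vec u)) * matK r s)) (l, k) (j, i) =
      ((matK r s).transpose.mulVec fun q => recip (vec u) q * matK r s q (j, i)) (l, k) := by
    rw [Matrix.mul_apply]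
    simp only [Matrix.mulVec, dotProduct, Matrix.diagonal_mul]
  rw [e, transpose_matK_mulVec]
  simp only [matL, Matrix.of_apply, h1, h2, h3, matK_apply, matH_castSucc, matH_last, recip, vec,
    Matrix.vec]
  by_cases hk : k = i <;> by_cases hl : l = j <;>
    simp [hk, hl, eq_comm] <;> ring

/-- The quadratic form of `L_u` at `θ` is `∑ (Kθ)² / u`. If it vanishes then `Kθ = 0`, and the
entries of `Kθ` off the last row and column are those of `θ`. -/
theorem matL_isUnit_det {u x : Mat (r + 1) (s + 1)}
    (hu : IsFit (unif (r + 1)) (unif (s + 1)) x u) : IsUnit (matL u).det := by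
  rw [isUnit_iff_ne_zero, ne_eq, ← Matrix.exists_mulVec_eq_zero_iff]
  rintro ⟨θ, hθ, h0⟩
  apply hθ
  set w := (matK r s).mulVec θ with hw
  have h1 : ∑ q, recip (vec u) q * w q ^ 2 = 0 := by
    have h2 : dotProduct θ ((matL u).mulVec θ) = 0 := by rw [h0]; simp
    rw [matL_eq hu, Matrix.mul_assoc, ← Matrix.mulVec_mulVec, ← Matrix.mulVec_mulVec,
      Matrix.dotProduct_mulVec, Matrix.vecMul_transpose, ← hw] at h2
    rw [← h2, dotProduct]
    refine Finset.sum_congr rfl fun q _ => ?_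
    rw [Matrix.mulVec_diagonal]; ring
  have hpos : ∀ q, 0 < recip (vec u) q := fun q => inv_pos.2 (hu.pos _ _)
  funext c
  have h3 := (Finset.sum_eq_zero_iff_of_nonneg
    (fun q _ => mul_nonneg (hpos q).le (sq_nonneg (w q)))).1 h1 (c.1.castSucc, c.2.castSucc)
    (Finset.mem_univ _)
  rcases mul_eq_zero.1 h3 with h | h
  · exact absurd h (hpos _).ne'
  · rw [hw, matK_mulVec_castSucc] at h
    simpa using h

/-- `M_p` has no column for the last cell. Its constant term `1 / p_rs`, summed against the other
entries of `h`, yields `-h_rs / p_rs` precisely because `h` has total `0`. -/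
theorem matM_mul_matN_mulVec {p h : Mat (r + 1) (s + 1)} (hp : ∑ i, ∑ j, p i j = 1)
    (hh : ∑ i, ∑ j, h i j = 0) :
    (matM p).mulVec ((matN r s).mulVec (vec h)) =
      - (matK r s).transpose.mulVec ((Matrix.diagonal (recip (vec p))).mulVec (vec h)) := by
  have hp' : ∑ q : Fin (s + 1) × Fin (r + 1), p q.2 q.1 = 1 := by
    rw [Fintype.sum_prod_type, Finset.sum_comm, ← hp]
  have hh' : ∑ q : Fin (s + 1) × Fin (r + 1), h q.2 q.1 = 0 := by
    rw [Fintype.sum_prod_type, Finset.sum_comm, ← hh]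
  have hN : (matN r s).mulVec (vec h) = fun c => h c.1.2 c.1.1 := by
    funext c
    simp [matN, Matrix.mulVec, dotProduct, vec, Matrix.vec]
  have hlast : 1 - ∑ c : Cells r s, p c.1.2 c.1.1 = p (Fin.last r) (Fin.last s) := by
    rw [Fintype.sum_eq_add_sum_subtype_ne _ (Fin.last s, Fin.last r)] at hp'
    linarith
  funext ⟨l, k⟩
  rw [Pi.neg_apply, transpose_matK_mulVec, hN]
  simp only [Matrix.mulVec_diagonal, recip, vec, Matrix.vec, Matrix.of_apply]
  set f : Fin (s + 1) × Fin (r + 1) → ℝ := fun q =>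
    (- (if q.2 = k.castSucc ∧ q.1 = l.castSucc then 1 / p k.castSucc l.castSucc else 0)
    + (if q.2 = Fin.last r ∧ q.1 = l.castSucc then 1 / p (Fin.last r) l.castSucc else 0)
    + (if q.2 = k.castSucc ∧ q.1 = Fin.last s then 1 / p k.castSucc (Fin.last s) else 0)
    + 1 / p (Fin.last r) (Fin.last s)) * h q.2 q.1 with hf
  have h1 : (matM p).mulVec (fun c => h c.1.2 c.1.1) (l, k) = ∑ c : Cells r s, f c.1 := by
    simp only [Matrix.mulVec, dotProduct, matM, Matrix.of_apply, hlast, hf]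
  have h2 := Fintype.sum_eq_add_sum_subtype_ne f (Fin.last s, Fin.last r)
  have h3 : ∑ q, f q = - (1 / p k.castSucc l.castSucc * h k.castSucc l.castSucc)
      + 1 / p (Fin.last r) l.castSucc * h (Fin.last r) l.castSucc
      + 1 / p k.castSucc (Fin.last s) * h k.castSucc (Fin.last s) := by
    simp only [hf, add_mul, neg_mul, Finset.sum_add_distrib, Finset.sum_neg_distrib, ite_mul,
      zero_mul, ← Finset.mul_sum, hh', mul_zero, add_zero]
    simp only [Fintype.sum_prod_type, ite_and]
    simp
  have h4 : f (Fin.last s, Fin.last r) =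
      1 / p (Fin.last r) (Fin.last s) * h (Fin.last r) (Fin.last s) := by
    simp [hf, (Fin.castSucc_ne_last _).symm]
  rw [h1]
  rw [h3, h4] at h2
  simp only [one_div] at h2
  linarith

end Jacobian

/-! ### Differentiability of the fit. -/

section Deriv

variable {r s : ℕ}

/-- The log odds ratios of a vectorized matrix with respect to the last row and column. -/
noncomputable def logOdds (r s : ℕ) (v : Fin (s + 1) × Fin (r + 1) → ℝ) : Fin s × Fin r → ℝ :=
  (matK r s).transpose.mulVec fun q => Real.log (v q)

/-- The continuous linear map `v ↦ A v`. -/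
noncomputable def mulVecCLM {ι κ : Type*} [Fintype ι] [Finite κ] (A : Matrix κ ι ℝ) : (ι → ℝ) →L[ℝ] (κ → ℝ) :=
  LinearMap.toContinuousLinearMap A.mulVecLin

@[simp]
theorem mulVecCLM_apply {ι κ : Type*} [Fintype ι] [Finite κ] (A : Matrix κ ι ℝ) (v : ι → ℝ) :
    mulVecCLM A v = A.mulVec v := rfl

/-- Vectorization as a continuous linear map. -/
noncomputable def vecCLM (m n : ℕ) : Mat m n →L[ℝ] (Fin n × Fin m → ℝ) :=
  LinearMap.toContinuousLinearMap
    { toFun := vec, map_add' := fun _ _ => rfl, map_smul' := fun _ _ => rfl }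

@[simp]
theorem vecCLM_apply {m n : ℕ} (x : Mat m n) : vecCLM m n x = vec x := rfl

/-- The inverse of vectorization as a continuous linear map. -/
noncomputable def unvecCLM (m n : ℕ) : (Fin n × Fin m → ℝ) →L[ℝ] Mat m n :=
  LinearMap.toContinuousLinearMap
    { toFun := unvec, map_add' := fun _ _ => rfl, map_smul' := fun _ _ => rfl }

@[simp]
theorem unvecCLM_apply {m n : ℕ} (v : Fin n × Fin m → ℝ) : unvecCLM m n v = unvec v := rfl

theorem hasStrictFDerivAt_log_pi {ι : Type*} [Fintype ι] [DecidableEq ι] {v : ι → ℝ}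
    (hv : ∀ i, v i ≠ 0) :
    HasStrictFDerivAt (fun (w : ι → ℝ) i => Real.log (w i))
      (mulVecCLM (Matrix.diagonal (recip v))) v := by
  rw [hasStrictFDerivAt_pi']
  intro i
  have h := (Real.hasStrictDerivAt_log (hv i)).comp_hasStrictFDerivAt v
    (ContinuousLinearMap.proj (R := ℝ) (φ := fun _ : ι => ℝ) i).hasStrictFDerivAt
  refine h.congr_fderiv ?_
  ext w
  simp [Matrix.mulVec_diagonal, recip]

theorem hasStrictFDerivAt_logOdds {v : Fin (s + 1) × Fin (r + 1) → ℝ} (hv : ∀ q, v q ≠ 0) :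
    HasStrictFDerivAt (logOdds r s)
      (mulVecCLM ((matK r s).transpose * Matrix.diagonal (recip v))) v := by
  refine ((mulVecCLM (matK r s).transpose).hasStrictFDerivAt.comp v
    (hasStrictFDerivAt_log_pi hv)).congr_fderiv ?_
  ext w : 1
  simp [Matrix.mulVec_mulVec]

/-- Odds ratios against the last row and column determine all others: equality of these makes `log y
- log x` a row term plus a column term. -/
theorem SameOdds.of_logOdds {x y : Mat (r + 1) (s + 1)} (hx : ∀ i j, 0 < x i j)
    (hy : ∀ i j, 0 < y i j) (h : logOdds r s (vec y) = logOdds r s (vec x)) : SameOdds x y := by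
  set d : Mat (r + 1) (s + 1) := fun i j => Real.log (y i j) - Real.log (x i j) with hd
  have hdd : ∀ i j, d i j = d i (Fin.last s) + d (Fin.last r) j - d (Fin.last r) (Fin.last s) := by
    intro i j
    induction i using Fin.lastCases with
    | last => ring
    | cast k =>
      induction j using Fin.lastCases with
      | last => ring
      | cast l =>
        have := congrFun h (l, k)
        simp only [logOdds, transpose_matK_mulVec, vec, Matrix.vec, Matrix.of_apply] at this
        simp only [hd]
        linarith
  intro i j g k
  have hx' := fun i j => (hx i j).ne'
  have hy' := fun i j => (hy i j).ne'
  refine Real.log_injOn_pos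
    (mul_pos (mul_pos (hy _ _) (hy _ _)) (mul_pos (hx _ _) (hx _ _)))
    (mul_pos (mul_pos (hx _ _) (hx _ _)) (mul_pos (hy _ _) (hy _ _))) ?_
  rw [Real.log_mul (mul_ne_zero (hy' _ _) (hy' _ _)) (mul_ne_zero (hx' _ _) (hx' _ _)),
    Real.log_mul (mul_ne_zero (hx' _ _) (hx' _ _)) (mul_ne_zero (hy' _ _) (hy' _ _)),
    Real.log_mul (hy' _ _) (hy' _ _), Real.log_mul (hy' _ _) (hy' _ _),
    Real.log_mul (hx' _ _) (hx' _ _), Real.log_mul (hx' _ _) (hx' _ _)]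
  have h1 := hdd i j
  have h2 := hdd g k
  have h3 := hdd i k
  have h4 := hdd g j
  simp only [hd] at h1 h2 h3 h4
  linarith

theorem SameOdds.logOdds_eq {x y : Mat (r + 1) (s + 1)} (hx : ∀ i j, 0 < x i j)
    (hy : ∀ i j, 0 < y i j) (h : SameOdds x y) : logOdds r s (vec y) = logOdds r s (vec x) := by
  funext ⟨l, k⟩
  have := congrArg Real.log (h k.castSucc l.castSucc (Fin.last r) (Fin.last s))
  have hx' := fun i j => (hx i j).ne'
  have hy' := fun i j => (hy i j).ne'
  rw [Real.log_mul (mul_ne_zero (hy' _ _) (hy' _ _)) (mul_ne_zero (hx' _ _) (hx' _ _)),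
    Real.log_mul (mul_ne_zero (hx' _ _) (hx' _ _)) (mul_ne_zero (hy' _ _) (hy' _ _)),
    Real.log_mul (hy' _ _) (hy' _ _), Real.log_mul (hy' _ _) (hy' _ _),
    Real.log_mul (hx' _ _) (hx' _ _), Real.log_mul (hx' _ _) (hx' _ _)] at this
  simp only [logOdds, transpose_matK_mulVec, vec, Matrix.vec, Matrix.of_apply]
  linarith

theorem eventually_pos {m n : ℕ} {x : Mat m n} (hx : ∀ i j, 0 < x i j) :
    ∀ᶠ y in 𝓝 x, ∀ i j, 0 < y i j := by
  rw [eventually_all]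
  intro i
  rw [eventually_all]
  intro j
  have hc : Continuous fun y : Mat m n => y i j := by fun_prop
  exact hc.continuousAt.eventually (lt_mem_nhds (hx i j))

theorem exists_hasFDerivAt_unifIPFP {p : Mat (r + 1) (s + 1)} (hpos : ∀ i j, 0 < p i j)
    (hp1 : ∑ i, ∑ j, p i j = 1) :
    ∃ D : Mat (r + 1) (s + 1) →L[ℝ] Mat (r + 1) (s + 1), HasFDerivAt unifIPFP D p ∧
      ∀ h, ∑ i, ∑ j, h i j = 0 → D h = unifIPFPDeriv p h := by
  set u := unifIPFP p with hu
  have hfit : IsFit (unif (r + 1)) (unif (s + 1)) p u := isFit_unifIPFP hpos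
  have hdet := matL_isUnit_det hfit
  set A : (Fin s × Fin r → ℝ) → (Fin (s + 1) × Fin (r + 1) → ℝ) :=
    fun θ => vec u + mulVecCLM (matK r s) θ with hA
  have hA0 : A 0 = vec u := by simp [hA]
  have hAd : HasStrictFDerivAt A (mulVecCLM (matK r s)) 0 :=
    (mulVecCLM (matK r s)).hasStrictFDerivAt.const_add _
  let e : (Fin s × Fin r → ℝ) ≃L[ℝ] (Fin s × Fin r → ℝ) :=
    ContinuousLinearEquiv.equivOfInverse (mulVecCLM (matL u)) (mulVecCLM (matL u)⁻¹)
      (fun θ => by simp [Matrix.mulVec_mulVec, Matrix.nonsing_inv_mul _ hdet])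
      (fun θ => by simp [Matrix.mulVec_mulVec, Matrix.mul_nonsing_inv _ hdet])
  have hΛ : HasStrictFDerivAt (fun θ => logOdds r s (A θ))
      (e : (Fin s × Fin r → ℝ) →L[ℝ] (Fin s × Fin r → ℝ)) 0 := by
    have h1 : HasStrictFDerivAt (logOdds r s)
        (mulVecCLM ((matK r s).transpose * Matrix.diagonal (recip (vec u)))) (A 0) := by
      rw [hA0]
      exact hasStrictFDerivAt_logOdds fun q => (hfit.pos _ _).ne'
    refine (h1.comp 0 hAd).congr_fderiv ?_
    ext θ : 1
    simp [e, Matrix.mulVec_mulVec, matL_eq hfit]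
  have hΛ0 : logOdds r s (A 0) = logOdds r s (vec p) := by
    rw [hA0]; exact hfit.odds.logOdds_eq hpos hfit.pos
  set G := hΛ.localInverse with hG
  have hGd : HasStrictFDerivAt G
      (e.symm : (Fin s × Fin r → ℝ) →L[ℝ] (Fin s × Fin r → ℝ)) (logOdds r s (vec p)) := by
    have := hΛ.to_localInverse
    rwa [hΛ0] at this
  have hG0 : G (logOdds r s (vec p)) = 0 := by
    have := hΛ.localInverse_apply_image
    rwa [hΛ0] at this
  have hlo : HasFDerivAt (fun x : Mat (r + 1) (s + 1) => logOdds r s (vec x))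
      ((mulVecCLM ((matK r s).transpose * Matrix.diagonal (recip (vec p)))).comp
        (vecCLM (r + 1) (s + 1))) p :=
    (hasStrictFDerivAt_logOdds (v := vec p) fun q => (hpos _ _).ne').hasFDerivAt.comp p
      (vecCLM (r + 1) (s + 1)).hasFDerivAt
  -- The candidate for the fit near `p`: it has the margins of `u` by construction and the log odds
  -- ratios of `x` by the choice of `G`. Near `p` it is also positive, so uniqueness identifies it
  -- with `unifIPFP x`.
  set V : Mat (r + 1) (s + 1) → Mat (r + 1) (s + 1) :=
    fun x => u + unvecCLM _ _ (mulVecCLM (matK r s) (G (logOdds r s (vec x)))) with hV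
  set D : Mat (r + 1) (s + 1) →L[ℝ] Mat (r + 1) (s + 1) :=
    (unvecCLM (r + 1) (s + 1)).comp ((mulVecCLM (matK r s)).comp
      ((e.symm : (Fin s × Fin r → ℝ) →L[ℝ] (Fin s × Fin r → ℝ)).comp
      ((mulVecCLM ((matK r s).transpose * Matrix.diagonal (recip (vec p)))).comp
        (vecCLM (r + 1) (s + 1))))) with hD
  have hVd : HasFDerivAt V D p := by
    refine HasFDerivAt.const_add _ ?_
    exact (unvecCLM _ _).hasFDerivAt.comp p ((mulVecCLM (matK r s)).hasFDerivAt.comp p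
      (HasFDerivAt.comp p hGd.hasFDerivAt hlo))
  have hVp : V p = u := by
    simp only [hV, hG0, map_zero, add_zero]
  have hevG : ∀ᶠ x in 𝓝 p, logOdds r s (A (G (logOdds r s (vec x)))) = logOdds r s (vec x) := by
    have h1 := hΛ.eventually_right_inverse
    rw [hΛ0] at h1
    exact hlo.continuousAt.eventually h1
  have hevV : ∀ᶠ x in 𝓝 p, ∀ i j, 0 < V x i j := by
    have h1 := eventually_pos hfit.pos
    rw [← hVp] at h1
    exact hVd.continuousAt.eventually h1
  refine ⟨D, hVd.congr_of_eventuallyEq ?_, fun h hh => ?_⟩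
  · filter_upwards [hevG, hevV, eventually_pos hpos] with x h1 h2 h3
    refine IsFit.eq h3 (isFit_unifIPFP h3) ⟨h2, fun i => ?_, fun j => ?_, ?_⟩
    · simp only [hV, Pi.add_apply, Finset.sum_add_distrib, unvecCLM_apply, mulVecCLM_apply,
        sum_unvec_matK_row, add_zero, hfit.row]
    · simp only [hV, Pi.add_apply, Finset.sum_add_distrib, unvecCLM_apply, mulVecCLM_apply,
        sum_unvec_matK_col, add_zero, hfit.col]
    · exact SameOdds.of_logOdds h3 h2 h1
  · have h1 := matM_mul_matN_mulVec hp1 hh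
    have h2 : D h = unvec ((matK r s).mulVec ((matL u)⁻¹.mulVec
        ((matK r s).transpose.mulVec ((Matrix.diagonal (recip (vec p))).mulVec (vec h))))) := by
      simp only [hD, ContinuousLinearMap.comp_apply, vecCLM_apply, mulVecCLM_apply, unvecCLM_apply,
        ← Matrix.mulVec_mulVec]
      rfl
    rw [h2, unifIPFPDeriv, matJ, Matrix.neg_mulVec, ← Matrix.mulVec_mulVec, ← Matrix.mulVec_mulVec,
      ← Matrix.mulVec_mulVec, h1, Matrix.mulVec_neg, Matrix.mulVec_neg, neg_neg]

/-- `unifIPFPDeriv p` as a continuous linear map. -/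
noncomputable def unifIPFPDerivCLM (p : Mat (r + 1) (s + 1)) :
    Mat (r + 1) (s + 1) →L[ℝ] Mat (r + 1) (s + 1) :=
  (unvecCLM (r + 1) (s + 1)).comp
    ((mulVecCLM (matJ (unifIPFP p) p)).comp (vecCLM (r + 1) (s + 1)))

end Deriv

end CopulaPMF

namespace CopulaPMF

/-! ### Tightness and the delta method. -/

section Delta

variable {Ω Ω' : Type*} [MeasurableSpace Ω] [MeasurableSpace Ω']
  {P : Measure Ω} [IsProbabilityMeasure P] {P' : Measure Ω'} [IsProbabilityMeasure P']

/-- A sequence that converges in distribution is bounded in probability. -/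
theorem exists_norm_bound_of_tendstoInDistribution {E : Type*} [NormedAddCommGroup E]
    [CompleteSpace E] [SecondCountableTopology E] [MeasurableSpace E] [BorelSpace E]
    {T : ℕ → Ω → E} {Z : Ω' → E} (h : TendstoInDistribution T atTop Z (fun _ => P) P')
    {ε : ENNReal} (hε : 0 < ε) :
    ∃ K : ℝ, 0 < K ∧ ∀ n, P {ω | K < ‖T n ω‖} ≤ ε := by
  have hcomp := h.tendsto.isCompact_insert_range
  have htight := isTightMeasureSet_of_isCompact_closure (by rwa [hcomp.isClosed.closure_eq])
  -- The laws together with their limit form a compact set, hence a tight one by Prokhorov's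
  -- theorem.
  obtain ⟨C, hC, hle⟩ := isTightMeasureSet_iff_exists_isCompact_measure_compl_le.1 htight ε hε
  obtain ⟨K, hK, hb⟩ := hC.isBounded.exists_pos_norm_le
  refine ⟨K, hK, fun n => ?_⟩
  have h1 := hle _ ⟨_, Or.inr ⟨n, rfl⟩, rfl⟩
  simp only [ProbabilityMeasure.coe_mk] at h1
  refine le_trans ?_ ((Measure.le_map_apply (h.forall_aemeasurable n) _).trans h1)
  refine measure_mono fun ω hω hmem => ?_
  exact absurd (hb _ hmem) (not_le.2 hω)

/-- The delta method: if `√n (Y n - p)` converges in distribution, `X n - Y n` is at most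
`1 / (n + 1)`, and `f` is differentiable at `p`, then `√n (f (X n) - f p)` has the linear
approximation `D (√n (Y n - p))`. -/
theorem tendstoInMeasure_delta {E F : Type*} [NormedAddCommGroup E] [NormedSpace ℝ E]
    [CompleteSpace E] [SecondCountableTopology E] [MeasurableSpace E] [BorelSpace E]
    [NormedAddCommGroup F] [NormedSpace ℝ F] {f : E → F} {D : E →L[ℝ] F} {p : E}
    (hf : HasFDerivAt f D p) {X Y : ℕ → Ω → E} {Z : Ω' → E}
    (hXY : ∀ n ω, ‖X n ω - Y n ω‖ ≤ 1 / ((n : ℝ) + 1))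
    (hY : TendstoInDistribution (fun (n : ℕ) ω => √(n : ℝ) • (Y n ω - p)) atTop Z
      (fun _ => P) P') :
    TendstoInMeasure P
      (fun (n : ℕ) ω => √(n : ℝ) • (f (X n ω) - f p) - D (√(n : ℝ) • (Y n ω - p)))
      atTop (fun _ => 0) := by
  rw [tendstoInMeasure_iff_norm]
  intro δ hδ
  simp only [sub_zero]
  rw [ENNReal.tendsto_nhds_zero]
  intro ε hε
  obtain ⟨K, hK, hKP⟩ := exists_norm_bound_of_tendstoInDistribution hY hε
  -- On the event `√n ‖Y n - p‖ ≤ K`, also `√n ‖X n - p‖ ≤ K + 1`. The remainder is then at most `η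
  -- (K + 1) < δ / 2`, and replacing `Y n` by `X n` inside `D` costs at most `‖D‖ / √n`.
  set η := δ / 2 / (K + 1) / 2 with hη
  have hηpos : 0 < η := by positivity
  have hη' : η * (K + 1) < δ / 2 := by
    rw [hη]; field_simp; linarith
  obtain ⟨ρ, hρ, hball⟩ := Metric.eventually_nhds_iff.1 (hf.isLittleO.def hηpos)
  have hsq : Tendsto (fun n : ℕ => √(n : ℝ)) atTop atTop :=
    Real.tendsto_sqrt_atTop.comp tendsto_natCast_atTop_atTop
  have hsq0 : Tendsto (fun n : ℕ => (√(n : ℝ))⁻¹) atTop (𝓝 0) := tendsto_inv_atTop_zero.comp hsq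
  have hev1 : ∀ᶠ n : ℕ in atTop, (K + 1) * (√(n : ℝ))⁻¹ < ρ := by
    have := hsq0.const_mul (K + 1)
    rw [mul_zero] at this
    exact this.eventually (gt_mem_nhds hρ)
  have hev2 : ∀ᶠ n : ℕ in atTop, ‖D‖ * (√(n : ℝ))⁻¹ < δ / 2 := by
    have := hsq0.const_mul ‖D‖
    rw [mul_zero] at this
    exact this.eventually (gt_mem_nhds (half_pos hδ))
  filter_upwards [hev1, hev2, eventually_ge_atTop 1] with n h1 h2 hn
  refine le_trans (measure_mono fun ω hω => ?_) (hKP n)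
  by_contra hcon
  simp only [Set.mem_ofPred_eq, not_lt] at hω hcon
  have hn1 : (1 : ℝ) ≤ n := by exact_mod_cast hn
  set q := √(n : ℝ) with hq
  have hq1 : 1 ≤ q := Real.one_le_sqrt.2 hn1
  have hq0 : 0 < q := by linarith
  have hqq : q * q = n := Real.mul_self_sqrt (by linarith)
  have hsmall : 1 / ((n : ℝ) + 1) * q ≤ q⁻¹ := by
    rw [← hqq, one_div_mul_eq_div, div_le_iff₀ (by positivity)]
    field_simp
    nlinarith
  have hqi : q⁻¹ ≤ 1 := inv_le_one_of_one_le₀ hq1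
  have hd : q * ‖X n ω - Y n ω‖ ≤ q⁻¹ := by
    calc q * ‖X n ω - Y n ω‖ ≤ q * (1 / ((n : ℝ) + 1)) :=
          mul_le_mul_of_nonneg_left (hXY n ω) hq0.le
      _ ≤ q⁻¹ := by rw [mul_comm]; exact hsmall
  have hYn : q * ‖Y n ω - p‖ ≤ K := by
    rwa [norm_smul, Real.norm_of_nonneg hq0.le] at hcon
  have hXn : q * ‖X n ω - p‖ ≤ K + 1 := by
    have : ‖X n ω - p‖ ≤ ‖X n ω - Y n ω‖ + ‖Y n ω - p‖ := norm_sub_le_norm_sub_add_norm_sub _ _ _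
    have := mul_le_mul_of_nonneg_left this hq0.le
    linarith
  have hdist : dist (X n ω) p < ρ := by
    rw [dist_eq_norm]
    refine lt_of_le_of_lt ?_ h1
    rw [← div_eq_mul_inv, le_div_iff₀ hq0]
    linarith
  have hrem := hball hdist
  have hsplit : q • (f (X n ω) - f p) - D (q • (Y n ω - p)) =
      q • (f (X n ω) - f p - D (X n ω - p)) + q • D (X n ω - Y n ω) := by
    rw [map_smul, ← smul_sub, ← smul_add]
    congr 1
    rw [show X n ω - Y n ω = (X n ω - p) - (Y n ω - p) by abel, map_sub D (X n ω - p)]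
    abel
  have hfin : ‖q • (f (X n ω) - f p) - D (q • (Y n ω - p))‖ < δ := by
    rw [hsplit]
    refine lt_of_le_of_lt (norm_add_le _ _) ?_
    rw [norm_smul, norm_smul, Real.norm_of_nonneg hq0.le]
    have e1 : q * ‖f (X n ω) - f p - D (X n ω - p)‖ ≤ η * (K + 1) := by
      calc q * ‖f (X n ω) - f p - D (X n ω - p)‖ ≤ q * (η * ‖X n ω - p‖) :=
            mul_le_mul_of_nonneg_left hrem hq0.le
        _ = η * (q * ‖X n ω - p‖) := by ring
        _ ≤ η * (K + 1) := mul_le_mul_of_nonneg_left hXn hηpos.le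
    have e2 : q * ‖D (X n ω - Y n ω)‖ ≤ ‖D‖ * q⁻¹ := by
      calc q * ‖D (X n ω - Y n ω)‖ ≤ q * (‖D‖ * ‖X n ω - Y n ω‖) :=
            mul_le_mul_of_nonneg_left (D.le_opNorm _) hq0.le
        _ = ‖D‖ * (q * ‖X n ω - Y n ω‖) := by ring
        _ ≤ ‖D‖ * q⁻¹ := mul_le_mul_of_nonneg_left hd (norm_nonneg _)
    linarith
  exact absurd hω (not_le.2 hfin)

end Delta

/-! ### Bounds and measurability for the estimators. -/

section Counts

variable {Ω : Type*} {m n : ℕ}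

theorem counts_nonneg (X : ℕ → Ω → Fin m) (Y : ℕ → Ω → Fin n) (N : ℕ) (ω : Ω) (i : Fin m)
    (j : Fin n) : 0 ≤ counts X Y N ω i j :=
  Finset.sum_nonneg fun k _ => by split_ifs <;> simp

theorem counts_le (X : ℕ → Ω → Fin m) (Y : ℕ → Ω → Fin n) (N : ℕ) (ω : Ω) (i : Fin m)
    (j : Fin n) : counts X Y N ω i j ≤ N := by
  have : counts X Y N ω i j ≤ ∑ _k ∈ Finset.range N, (1 : ℝ) :=
    Finset.sum_le_sum fun k _ => by split_ifs <;> simp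
  simpa using this

theorem sum_counts (X : ℕ → Ω → Fin m) (Y : ℕ → Ω → Fin n) (N : ℕ) (ω : Ω)
    (f : Fin m → Fin n → ℝ) :
    ∑ i, ∑ j, counts X Y N ω i j * f i j = ∑ k ∈ Finset.range N, f (X k ω) (Y k ω) := by
  simp only [counts, Finset.sum_mul]
  rw [Finset.sum_congr rfl fun i _ => Finset.sum_comm, Finset.sum_comm]
  refine Finset.sum_congr rfl fun k _ => ?_
  simp [ite_and]

theorem sum_empPMF (X : ℕ → Ω → Fin m) (Y : ℕ → Ω → Fin n) {N : ℕ} (hN : N ≠ 0) (ω : Ω) :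
    ∑ i, ∑ j, empPMF X Y N ω i j = 1 := by
  have h := sum_counts X Y N ω fun _ _ => 1
  simp only [mul_one, Finset.sum_const, Finset.card_range, nsmul_eq_mul] at h
  simp only [empPMF, ← Finset.mul_sum, h]
  have : (N : ℝ) ≠ 0 := by exact_mod_cast hN
  field_simp

theorem smoothPMF_pos {r s : ℕ} (X : ℕ → Ω → Fin (r + 1)) (Y : ℕ → Ω → Fin (s + 1)) (N : ℕ)
    (ω : Ω) (i : Fin (r + 1)) (j : Fin (s + 1)) : 0 < smoothPMF X Y N ω i j := by
  have := counts_nonneg X Y N ω i j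
  simp only [smoothPMF]
  positivity

/-- The difference is `1 / (N + 1)` times a difference of two numbers in `[0, 1]`. For `N = 0` the
convention `1 / 0 = 0` makes `empPMF` zero, and the bound persists. -/
theorem norm_smoothPMF_sub_empPMF_le (X : ℕ → Ω → Fin m) (Y : ℕ → Ω → Fin n) (N : ℕ) (ω : Ω) :
    ‖smoothPMF X Y N ω - empPMF X Y N ω‖ ≤ 1 / ((N : ℝ) + 1) := by
  have h0 : 0 ≤ 1 / ((N : ℝ) + 1) := by positivity
  refine (pi_norm_le_iff_of_nonneg h0).2 fun i => (pi_norm_le_iff_of_nonneg h0).2 fun j => ?_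
  have e : (smoothPMF X Y N ω - empPMF X Y N ω) i j
      = 1 / ((N : ℝ) + 1) * (1 / ((m : ℝ) * n) - empPMF X Y N ω i j) := by
    simp only [Pi.sub_apply, smoothPMF, empPMF]
    rcases Nat.eq_zero_or_pos N with rfl | hN
    · simp [counts]
    · have : (N : ℝ) ≠ 0 := by positivity
      have : (N : ℝ) + 1 ≠ 0 := by positivity
      field_simp
      ring
  rw [e, norm_mul, Real.norm_of_nonneg h0]
  refine mul_le_of_le_one_right h0 ?_
  have h1 : 0 ≤ empPMF X Y N ω i j :=
    mul_nonneg (by positivity) (counts_nonneg X Y N ω i j)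
  have h2 : empPMF X Y N ω i j ≤ 1 := by
    rcases Nat.eq_zero_or_pos N with rfl | hN
    · simp [empPMF]
    · have h3 := counts_le X Y N ω i j
      have : (0 : ℝ) < N := by positivity
      simp only [empPMF]
      rw [one_div_mul_eq_div, div_le_one this]
      exact h3
  have h4 : 0 ≤ 1 / ((m : ℝ) * n) := by positivity
  have h5 : 1 / ((m : ℝ) * n) ≤ 1 := by
    have hm : (1 : ℝ) ≤ m := by exact_mod_cast i.pos
    have hn : (1 : ℝ) ≤ n := by exact_mod_cast j.pos
    rw [div_le_one (by positivity)]
    nlinarith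
  rw [Real.norm_eq_abs, abs_le]
  constructor <;> linarith

variable [MeasurableSpace Ω]

/-- Every function of the first `N` counts is measurable. -/
theorem measurable_comp_counts {β : Type*} [MeasurableSpace β] {X : ℕ → Ω → Fin m}
    {Y : ℕ → Ω → Fin n} (hX : ∀ k, Measurable (X k)) (hY : ∀ k, Measurable (Y k)) (N : ℕ)
    (f : Mat m n → β) : Measurable fun ω => f (counts X Y N ω) := by
  have h1 : Measurable fun ω => fun k : Fin N => (X k ω, Y k ω) :=
    measurable_pi_lambda _ fun k => (hX k).prodMk (hY k)
  -- The counts factor through the first `N` observations, which take values in a finite discrete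
  -- space. No regularity of `f` is needed, so this applies to `unifIPFP`.
  have h2 : (fun ω => f (counts X Y N ω)) =
      (fun w : Fin N → Fin m × Fin n =>
        f fun i j => ∑ k, if (w k).1 = i ∧ (w k).2 = j then (1 : ℝ) else 0) ∘
      fun ω => fun k : Fin N => (X k ω, Y k ω) := by
    funext ω
    simp only [Function.comp]
    congr 1
    funext i j
    simp only [counts, Finset.sum_range]
  rw [h2]
  exact Measurable.of_discrete.comp h1

theorem measurable_empPMF {X : ℕ → Ω → Fin m} {Y : ℕ → Ω → Fin n} (hX : ∀ k, Measurable (X k))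
    (hY : ∀ k, Measurable (Y k)) (N : ℕ) : Measurable (empPMF X Y N) :=
  measurable_comp_counts hX hY N fun c i j => 1 / (N : ℝ) * c i j

theorem measurable_empCopula {X : ℕ → Ω → Fin m} {Y : ℕ → Ω → Fin n}
    (hX : ∀ k, Measurable (X k)) (hY : ∀ k, Measurable (Y k)) (N : ℕ) :
    Measurable (empCopula X Y N) :=
  measurable_comp_counts hX hY N fun c =>
    unifIPFP fun i j => 1 / ((N : ℝ) + 1) * (c i j + 1 / ((m : ℝ) * (n : ℝ)))

end Counts

/-! ### The limit theorem for the empirical copula mass function. -/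

section Limit

variable {Ω Ω' : Type*} [MeasurableSpace Ω] [MeasurableSpace Ω']
  {P : Measure Ω} [IsProbabilityMeasure P] {P' : Measure Ω'} [IsProbabilityMeasure P']

theorem integral_comp_cell {m n : ℕ} {p : Mat m n} {X : Ω → Fin m} {Y : Ω → Fin n}
    (hX : Measurable X) (hY : Measurable Y)
    (hp : ∀ i j, P.real {ω | X ω = i ∧ Y ω = j} = p i j) (f : Fin m × Fin n → ℝ) :
    ∫ ω, f (X ω, Y ω) ∂P = ∑ i, ∑ j, p i j * f (i, j) := by
  have hXY : Measurable fun ω => (X ω, Y ω) := hX.prodMk hY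
  have : IsProbabilityMeasure (P.map fun ω => (X ω, Y ω)) :=
    Measure.isProbabilityMeasure_map hXY.aemeasurable
  rw [← integral_map (φ := fun ω => (X ω, Y ω)) hXY.aemeasurable
    Measurable.of_discrete.aestronglyMeasurable, integral_fintype .of_finite,
    Fintype.sum_prod_type]
  refine Finset.sum_congr rfl fun i _ => Finset.sum_congr rfl fun j _ => ?_
  rw [map_measureReal_apply hXY (measurableSet_singleton _), smul_eq_mul, ← hp i j]
  congr 2
  ext ω
  simp

theorem sum_pmf {m n : ℕ} {p : Mat m n} {X : Ω → Fin m} {Y : Ω → Fin n}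
    (hX : Measurable X) (hY : Measurable Y)
    (hp : ∀ i j, P.real {ω | X ω = i ∧ Y ω = j} = p i j) : ∑ i, ∑ j, p i j = 1 := by
  have := integral_comp_cell hX hY hp fun _ => 1
  simpa using this.symm

theorem tendstoInMeasure_empCopula {r s : ℕ} {p : Mat (r + 1) (s + 1)}
    (hpos : ∀ i j, 0 < p i j) (hp1 : ∑ i, ∑ j, p i j = 1)
    {X : ℕ → Ω → Fin (r + 1)} {Y : ℕ → Ω → Fin (s + 1)} {Z : Ω' → Mat (r + 1) (s + 1)}
    (h : TendstoInDistribution (fun (n : ℕ) ω => √(n : ℝ) • (empPMF X Y n ω - p)) atTop Z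
      (fun _ => P) P') :
    TendstoInMeasure P
      (fun (n : ℕ) ω => √(n : ℝ) • (empCopula X Y n ω - unifIPFP p)
        - unifIPFPDeriv p (√(n : ℝ) • (empPMF X Y n ω - p)))
      atTop (fun _ => 0) := by
  obtain ⟨D, hD, hDJ⟩ := exists_hasFDerivAt_unifIPFP hpos hp1
  have h1 := tendstoInMeasure_delta hD (fun n ω => norm_smoothPMF_sub_empPMF_le X Y n ω) h
  refine h1.congr_left fun n => Eventually.of_forall fun ω => ?_
  -- Both mass functions have total `1`, so the derivative is only evaluated where it agrees with
  -- `unifIPFPDeriv p`. For `n = 0` the factor `√0` vanishes.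
  have h2 : ∑ i, ∑ j, (√(n : ℝ) • (empPMF X Y n ω - p)) i j = 0 := by
    simp only [Pi.smul_apply, Pi.sub_apply, smul_eq_mul, ← Finset.mul_sum, Finset.sum_sub_distrib,
      hp1]
    rcases eq_or_ne n 0 with rfl | hn
    · simp
    · rw [sum_empPMF X Y hn]; simp
  simp only [hDJ _ h2]
  rfl

theorem tendstoInDistribution_empCopula {r s : ℕ} {p : Mat (r + 1) (s + 1)}
    (hpos : ∀ i j, 0 < p i j) (hp1 : ∑ i, ∑ j, p i j = 1)
    {X : ℕ → Ω → Fin (r + 1)} {Y : ℕ → Ω → Fin (s + 1)}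
    (hX : ∀ k, Measurable (X k)) (hY : ∀ k, Measurable (Y k)) {Z : Ω' → Mat (r + 1) (s + 1)}
    (h : TendstoInDistribution (fun (n : ℕ) ω => √(n : ℝ) • (empPMF X Y n ω - p)) atTop Z
      (fun _ => P) P') :
    TendstoInDistribution (fun (n : ℕ) ω => √(n : ℝ) • (empCopula X Y n ω - unifIPFP p)) atTop
      (fun ω => unifIPFPDeriv p (Z ω)) (fun _ => P) P' := by
  have h1 := h.continuous_comp (unifIPFPDerivCLM p).continuous
  refine tendstoInDistribution_of_tendstoInMeasure_sub _ _ h1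
    (tendstoInMeasure_empCopula hpos hp1 h) fun n => ?_
  have hm : Measurable fun ω => √(n : ℝ) • (empCopula X Y n ω - unifIPFP p) :=
    ((measurable_empCopula hX hY n).sub_const _).const_smul (√(n : ℝ))
  exact hm.aemeasurable

end Limit

end CopulaPMF

namespace CopulaPMF

/-! ### The normal limit for independent observations. -/

section Gaussian

variable {Ω Ω' : Type*} [MeasurableSpace Ω] [MeasurableSpace Ω']
  {P : Measure Ω} [IsProbabilityMeasure P] {P' : Measure Ω'} [IsProbabilityMeasure P']

/-- The right side is the variance of `t (Y, X)` when `(X, Y)` has mass function `p`; this links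
`covMat` to the scalar central limit theorem. -/
theorem dotProduct_covMat_mulVec {m n : ℕ} (p : Mat m n) (t : Fin n × Fin m → ℝ) :
    dotProduct t ((covMat p).mulVec t) =
      ∑ i, ∑ j, p i j * t (j, i) ^ 2 - (∑ i, ∑ j, p i j * t (j, i)) ^ 2 := by
  have h1 : ∀ f : Fin n × Fin m → ℝ, ∑ i, ∑ j, f (j, i) = ∑ q, f q := fun f => by
    rw [Fintype.sum_prod_type, Finset.sum_comm]
  rw [h1 fun q => p q.2 q.1 * t q ^ 2, h1 fun q => p q.2 q.1 * t q]
  simp only [covMat, Matrix.sub_mulVec, dotProduct, Pi.sub_apply, mul_sub, Finset.sum_sub_distrib,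
    Matrix.mulVec_diagonal, Matrix.vecMulVec_mulVec]
  congr 1
  · exact Finset.sum_congr rfl fun q _ => by simp only [vec, Matrix.vec, Matrix.of_apply]; ring
  · rw [sq, Finset.sum_mul]
    refine Finset.sum_congr rfl fun q _ => ?_
    simp only [vec, Matrix.vec, Matrix.of_apply, Pi.smul_apply, MulOpposite.smul_eq_mul_unop,
      MulOpposite.unop_op]
    ring

theorem posSemidef_covMat {m n : ℕ} {p : Mat m n} (hp : ∀ i j, 0 ≤ p i j)
    (hp1 : ∑ i, ∑ j, p i j = 1) : (covMat p).PosSemidef := by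
  refine .of_dotProduct_mulVec_nonneg ?_ fun t => ?_
  · simp only [Matrix.IsHermitian, covMat, Matrix.conjTranspose_eq_transpose_of_trivial,
      Matrix.transpose_sub, Matrix.diagonal_transpose, Matrix.transpose_vecMulVec]
  · rw [star_trivial, dotProduct_covMat_mulVec]
    set μ := ∑ i, ∑ j, p i j * t (j, i) with hμ
    have h : 0 ≤ ∑ i, ∑ j, p i j * (t (j, i) - μ) ^ 2 :=
      Finset.sum_nonneg fun i _ => Finset.sum_nonneg fun j _ => mul_nonneg (hp i j) (sq_nonneg _)
    have e : ∀ i j, p i j * (t (j, i) - μ) ^ 2 =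
        p i j * t (j, i) ^ 2 - 2 * μ * (p i j * t (j, i)) + μ ^ 2 * p i j := fun i j => by ring
    simp only [e, Finset.sum_add_distrib, Finset.sum_sub_distrib, ← Finset.mul_sum, hp1, ← hμ] at h
    linarith

/-- The image of a multivariate Gaussian under a matrix. -/
theorem hasLaw_mulVec {ι : Type*} [Fintype ι] [DecidableEq ι] {S : Matrix ι ι ℝ}
    (hS : S.PosSemidef) (A : Matrix ι ι ℝ) {W : Ω' → ι → ℝ}
    (hW : HasLaw (fun ω => WithLp.toLp 2 (W ω)) (multivariateGaussian 0 S) P') :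
    HasLaw (fun ω => WithLp.toLp 2 (A.mulVec (W ω)))
      (multivariateGaussian 0 (A * S * A.transpose)) P' := by
  have hS' : (A * S * A.transpose).PosSemidef := by
    have := hS.mul_mul_conjTranspose_same A
    rwa [Matrix.conjTranspose_eq_transpose_of_trivial] at this
  set g : EuclideanSpace ℝ ι → EuclideanSpace ℝ ι :=
    fun x => WithLp.toLp 2 (A.mulVec (WithLp.ofLp x)) with hg
  have hgm : Measurable g := by
    have : Continuous g := by fun_prop
    exact this.measurable
  have hAW : AEMeasurable (fun ω => WithLp.toLp 2 (A.mulVec (W ω))) P' :=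
    hgm.comp_aemeasurable hW.aemeasurable
  refine ⟨hAW, ?_⟩
  have := Measure.isProbabilityMeasure_map (μ := P') hAW
  refine Measure.ext_of_charFun ?_
  funext t
  rw [charFun_multivariateGaussian hS', charFun_apply, integral_map hAW (by fun_prop)]
  have h1 := charFun_multivariateGaussian (μ := 0) hS (WithLp.toLp 2 (A.transpose.mulVec t.ofLp))
  rw [← hW.map_eq, charFun_apply, integral_map hW.aemeasurable (by fun_prop)] at h1
  -- Moving `A` to the other side of the inner product reduces the characteristic function of the
  -- image at `t` to that of `W` at `Aᵀ t`.
  have h2 : ∀ ω, inner ℝ (WithLp.toLp 2 (A.mulVec (W ω))) t =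
      inner ℝ (WithLp.toLp 2 (W ω)) (WithLp.toLp 2 (A.transpose.mulVec t.ofLp)) := fun ω => by
    simp only [EuclideanSpace.inner_eq_star_dotProduct, star_trivial]
    rw [Matrix.dotProduct_mulVec, Matrix.mulVec_transpose]
  simp only [h2]
  rw [h1]
  congr 1
  simp only [inner_zero_right]
  congr 3
  rw [← Matrix.mulVec_mulVec, ← Matrix.mulVec_mulVec, Matrix.dotProduct_mulVec t.ofLp A,
    Matrix.mulVec_transpose]

/-- The central limit theorem for the empirical probability mass function. -/
theorem tendstoInDistribution_toLp_empPMF {m n : ℕ} {p : Mat m n} (hpos : ∀ i j, 0 ≤ p i j)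
    (hp1 : ∑ i, ∑ j, p i j = 1) {X : ℕ → Ω → Fin m} {Y : ℕ → Ω → Fin n}
    (hX : ∀ k, Measurable (X k)) (hY : ∀ k, Measurable (Y k))
    (hp : ∀ k i j, P.real {ω | X k ω = i ∧ Y k ω = j} = p i j)
    (hind : iIndepFun (fun k ω => (X k ω, Y k ω)) P)
    {W : Ω' → EuclideanSpace ℝ (Fin n × Fin m)}
    (hW : HasLaw W (multivariateGaussian 0 (covMat p)) P') :
    TendstoInDistribution
      (fun (N : ℕ) ω => WithLp.toLp 2 (vec (√(N : ℝ) • (empPMF X Y N ω - p)))) atTop W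
      (fun _ => P) P' := by
  have hvec : Continuous fun x : Mat m n => WithLp.toLp 2 (vec x) := by
    have := (vecCLM m n).continuous
    simp only [← vecCLM_apply]
    fun_prop
  have hS : ∀ N : ℕ,
      Measurable fun ω => WithLp.toLp 2 (vec (√(N : ℝ) • (empPMF X Y N ω - p))) := fun N =>
    hvec.measurable.comp (((measurable_empPMF hX hY N).sub_const p).const_smul (√(N : ℝ)))
  refine ⟨fun N => (hS N).aemeasurable, hW.aemeasurable, ?_⟩
  refine ProbabilityMeasure.tendsto_iff_tendsto_charFun.2 fun t => ?_
  simp only [ProbabilityMeasure.coe_mk]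
  rw [hW.map_eq, charFun_multivariateGaussian (posSemidef_covMat hpos hp1)]
  set φ : Fin m × Fin n → ℝ := fun c => t (c.2, c.1) with hφ
  -- Cramér–Wold: the projection on `t` is a normalised sum of the variables `V k`, so the
  -- characteristic function at `t` is that of a scalar sum at `1`.
  set V : ℕ → Ω → ℝ := fun k ω => φ (X k ω, Y k ω) with hV
  have hcell : ∀ k, Measurable fun ω => (X k ω, Y k ω) := fun k => (hX k).prodMk (hY k)
  have hφm : Measurable φ := Measurable.of_discrete
  have hVm : ∀ k, Measurable (V k) := fun k => hφm.comp (hcell k)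
  have hident : ∀ k, IdentDistrib (V k) (V 0) P P := by
    intro k
    refine IdentDistrib.comp (u := φ) ⟨(hcell k).aemeasurable, (hcell 0).aemeasurable, ?_⟩ hφm
    refine Measure.ext_of_singleton fun c => ?_
    rw [Measure.map_apply (hcell k) (measurableSet_singleton _),
      Measure.map_apply (hcell 0) (measurableSet_singleton _), ← measureReal_eq_measureReal_iff]
    have e : ∀ k, (fun ω => (X k ω, Y k ω)) ⁻¹' {c} = {ω | X k ω = c.1 ∧ Y k ω = c.2} := by
      intro k; ext ω; simp [Prod.ext_iff]
    rw [e, e, hp, hp]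
  have hmean : P[V 0] = ∑ i, ∑ j, p i j * t (j, i) := integral_comp_cell (hX 0) (hY 0) (hp 0) φ
  have hmem : MemLp (V 0) 2 P := by
    obtain ⟨C, hC⟩ := Finite.exists_le fun c => ‖φ c‖
    exact MemLp.of_bound (hVm 0).aestronglyMeasurable C (Eventually.of_forall fun ω => hC _)
  have hvar : Var[V 0; P] = dotProduct t.ofLp ((covMat p).mulVec t.ofLp) := by
    rw [variance_eq_sub hmem, hmean, dotProduct_covMat_mulVec]
    congr 1
    exact integral_comp_cell (hX 0) (hY 0) (hp 0) fun c => φ c ^ 2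
  have hclt := tendstoInDistribution_inv_sqrt_mul_sum_sub (X := V) (P := P)
    (Y := id) (P' := gaussianReal 0 Var[V 0; P].toNNReal) ⟨aemeasurable_id, Measure.map_id⟩ hmem
    (hind.comp (fun _ => φ) fun _ => hφm) hident
  have h1 := ProbabilityMeasure.tendsto_iff_tendsto_charFun.1 hclt.tendsto 1
  simp only [ProbabilityMeasure.coe_mk, Measure.map_id, charFun_gaussianReal] at h1
  have hlim : Complex.exp (inner ℝ t (0 : EuclideanSpace ℝ (Fin n × Fin m)) * Complex.I
        - (dotProduct t.ofLp ((covMat p).mulVec t.ofLp) : ℝ) / 2) =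
      Complex.exp (((1 : ℝ) : ℂ) * ((0 : ℝ) : ℂ) * Complex.I
        - ((Var[V 0; P].toNNReal : ℝ) : ℂ) * ((1 : ℝ) : ℂ) ^ 2 / 2) := by
    rw [Real.coe_toNNReal _ (variance_nonneg _ _), hvar]
    simp
  have key : ∀ (N : ℕ) ω, inner ℝ (WithLp.toLp 2 (vec (√(N : ℝ) • (empPMF X Y N ω - p)))) t =
      (√(N : ℝ))⁻¹ * (∑ k ∈ Finset.range N, V k ω - N * P[V 0]) := by
    intro N ω
    have e1 : inner ℝ (WithLp.toLp 2 (vec (√(N : ℝ) • (empPMF X Y N ω - p)))) t =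
        ∑ i, ∑ j, √(N : ℝ) * (1 / (N : ℝ) * counts X Y N ω i j - p i j) * t (j, i) := by
      rw [PiLp.inner_apply, Fintype.sum_prod_type, Finset.sum_comm]
      refine Finset.sum_congr rfl fun i _ => Finset.sum_congr rfl fun j _ => ?_
      simp [vec, Matrix.vec, empPMF, mul_comm]
    have e2 := sum_counts X Y N ω fun i j => t (j, i)
    rw [e1, hmean]
    simp only [mul_sub, sub_mul, mul_assoc, Finset.sum_sub_distrib, ← Finset.mul_sum, e2]
    rcases Nat.eq_zero_or_pos N with rfl | hN
    · simp
    · have h0 : (0 : ℝ) < N := by exact_mod_cast hN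
      have h3 : √(N : ℝ) ≠ 0 := (Real.sqrt_pos.2 h0).ne'
      have h4 : √(N : ℝ) * (1 / (N : ℝ)) = (√(N : ℝ))⁻¹ := by
        rw [← Real.sqrt_div_self]; ring
      have h5 : (√(N : ℝ))⁻¹ * N = √(N : ℝ) := by
        rw [inv_mul_eq_div, Real.div_sqrt]
      rw [← mul_assoc (√(N : ℝ)) (1 / (N : ℝ)), h4, ← mul_assoc _ (N : ℝ), h5]
  rw [hlim]
  refine h1.congr fun N => ?_
  have hm1 : Measurable fun ω => (√(N : ℝ))⁻¹ * (∑ k ∈ Finset.range N, V k ω - N * P[V 0]) := by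
    fun_prop
  rw [charFun_apply, charFun_apply, integral_map hm1.aemeasurable (by fun_prop),
    integral_map (hS N).aemeasurable (by fun_prop)]
  refine integral_congr_ae (Eventually.of_forall fun ω => ?_)
  simp only [key]
  simp

end Gaussian

end CopulaPMF

open CopulaPMF in
theorem proposition3p2 {Ω Ω' : Type*} [MeasurableSpace Ω] [MeasurableSpace Ω']
    (P : Measure Ω) [IsProbabilityMeasure P] (P' : Measure Ω') [IsProbabilityMeasure P']
    -- the numbers of rows and columns are `r + 1 ≥ 1` and `s + 1 ≥ 1`
    (r s : ℕ) (p : Mat (r + 1) (s + 1)) (hpos : ∀ i j, 0 < p i j)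
    -- the observations, each of which has probability mass function `p`
    (X : ℕ → Ω → Fin (r + 1)) (Y : ℕ → Ω → Fin (s + 1))
    (hX : ∀ k, Measurable (X k)) (hY : ∀ k, Measurable (Y k))
    (hp : ∀ k i j, P.real {ω | X k ω = i ∧ Y k ω = j} = p i j)
    (Z : Ω' → Mat (r + 1) (s + 1)) :
    -- the objects in the statement exist
    IPFPConverges (unif (r + 1)) (unif (s + 1)) p ∧
    (∀ (n : ℕ) ω, IPFPConverges (unif (r + 1)) (unif (s + 1)) (smoothPMF X Y n ω)) ∧
    IsUnit (matL (unifIPFP p)).det ∧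
    -- the limit theorem
    (TendstoInDistribution (fun (n : ℕ) ω => √(n : ℝ) • (empPMF X Y n ω - p)) atTop Z (fun _ => P) P' →
      TendstoInMeasure P
        (fun (n : ℕ) ω => √(n : ℝ) • (empCopula X Y n ω - unifIPFP p)
          - unifIPFPDeriv p (√(n : ℝ) • (empPMF X Y n ω - p)))
        atTop (fun _ => 0) ∧
      TendstoInDistribution (fun (n : ℕ) ω => √(n : ℝ) • (empCopula X Y n ω - unifIPFP p)) atTop
        (fun ω => unifIPFPDeriv p (Z ω)) (fun _ => P) P' ∧
      (iIndepFun (fun k ω => (X k ω, Y k ω)) P →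
        HasLaw (fun ω => WithLp.toLp 2 (vec (Z ω))) (multivariateGaussian 0 (covMat p)) P' ∧
        HasLaw (fun ω => WithLp.toLp 2 (vec (unifIPFPDeriv p (Z ω))))
          (multivariateGaussian 0
            (matJ (unifIPFP p) p * covMat p * (matJ (unifIPFP p) p).transpose)) P')) ∧
    -- for independent observations, its assumption holds with a normal limit
    (iIndepFun (fun k ω => (X k ω, Y k ω)) P →
      HasLaw (fun ω => WithLp.toLp 2 (vec (Z ω))) (multivariateGaussian 0 (covMat p)) P' →
      TendstoInDistribution (fun (n : ℕ) ω => √(n : ℝ) • (empPMF X Y n ω - p)) atTop Z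
        (fun _ => P) P') := by
  have hp1 : ∑ i, ∑ j, p i j = 1 := sum_pmf (hX 0) (hY 0) (hp 0)
  have hnn : ∀ i j, 0 ≤ p i j := fun i j => (hpos i j).le
  have hconv : ∀ {x : Mat (r + 1) (s + 1)}, (∀ i j, 0 < x i j) →
      IPFPConverges (unif (r + 1)) (unif (s + 1)) x := fun hx =>
    let ⟨y, hy, _⟩ := exists_tendsto_unif hx
    ⟨y, hy⟩
  refine ⟨hconv hpos, fun n ω => hconv (smoothPMF_pos X Y n ω),
    matL_isUnit_det (isFit_unifIPFP hpos), fun h => ⟨tendstoInMeasure_empCopula hpos hp1 h,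
    tendstoInDistribution_empCopula hpos hp1 hX hY h, fun hind => ?_⟩, fun hind hZ => ?_⟩
  · have hvec : Continuous fun x : Mat (r + 1) (s + 1) => WithLp.toLp 2 (vec x) := by
      have := (vecCLM (r + 1) (s + 1)).continuous
      simp only [← vecCLM_apply]
      fun_prop
    have h1 := h.continuous_comp hvec
    -- The Gaussian measure itself, with the identity variable, serves as a second limit; uniqueness
    -- of limits in law then gives the law of `Z`.
    have h2 := tendstoInDistribution_toLp_empPMF hnn hp1 hX hY hp hind
      (P' := multivariateGaussian 0 (covMat p)) (W := id) ⟨aemeasurable_id, Measure.map_id⟩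
    have h3 := tendstoInDistribution_unique _ h1 h2
    rw [Measure.map_id] at h3
    have hZ : HasLaw (fun ω => WithLp.toLp 2 (vec (Z ω))) (multivariateGaussian 0 (covMat p)) P' :=
      ⟨h1.aemeasurable_limit, h3⟩
    exact ⟨hZ, hasLaw_mulVec (posSemidef_covMat hnn hp1) _ hZ⟩
  · have hunvec : Continuous fun v : EuclideanSpace ℝ (Fin (s + 1) × Fin (r + 1)) =>
        (unvec v.ofLp : Mat (r + 1) (s + 1)) := by
      have := (unvecCLM (r + 1) (s + 1)).continuous
      simp only [← unvecCLM_apply]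
      fun_prop
    exact (tendstoInDistribution_toLp_empPMF hnn hp1 hX hY hp hind hZ).continuous_comp hunvec
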